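/- **Setting.** There are $K\ge 1$ arms with features $x_1,\dots,x_K\in\mathbb{R}^d$; $L=\max_i\|x_i\|_2$. Pulling arm $a_t$ in round $t$ gives the reward $r_t=x_{a_t}^\top\theta+\varepsilon_t$, where $\theta\in\mathbb{R}^d$ is unknown with $\|\theta\|_2\le S$, $S>0$, and the noise is conditionally $R$-sub-Gaussian ($R\ge 0$): $\mathbb{E}[e^{s\varepsilon_t}\mid\mathcal{F}_{t-1}]\le e^{s^2R^2/2}$ for all $s\in\mathbb{R}$ and $t\ge 1$, where $\mathcal{F}_{t-1}$ contains the past arms and noises $a_1,\dots,a_{t-1},\varepsilon_1,\dots,\varepsilon_{t-1}$, and the choices made before the reward of round $t$ is observed (including $a_t$) are $\mathcal{F}_{t-1}$-measurable. Let $\varepsilon\ge 0$, $\delta\in(0,1)$, $\lambda>0$, $y(i,j)=x_i-x_j$, and let $a^*$ be a best arm, i.e. $x_{a^*}^\top\theta=\max_i x_i^\top\theta$; if $\varepsilon=0$, assume that $a^*$ is unique. **Ratios and complexity.** For each pair $(i,j)$ let $w^*(y(i,j))$ be a (fixed) minimizer of $\sum_k|w_k|$ subject to $y(i,j)=\sum_k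 w_kx_k$, and put $p^*_k(y)=|w^*_k(y)|/\sum_l|w^*_l(y)|$ (with $0/0=0$) and $\rho(y)=\sum_{k:\,p_k^*(y)>0} w_k^*(y)^2/p_k^*(y)=\bigl(\sum_k|w^*_k(y)|\bigr)^2$. Let $\Delta_i=(x_{a^*}-x_i)^\top\theta$ for $i\ne a^*$, $\Delta_{a^*}=\min_{j\ne a^*}\Delta_j$, and $$H_\varepsilon=\sum_{k=1}^K\max_{i,j}\frac{p_k^*(y(i,j))\,\rho(y(i,j))}{\max\left(\varepsilon,\frac{\varepsilon+\Delta_i}{3},\frac{\varepsilon+\Delta_j}{3}\right)^2},$$ where terms with numerator $0$ count as $0$. **Algorithm (LinGapE with the ratio rule).** In rounds $1,\dots,K$ pull arms $1,\dots,K$. After $t\ge K$ rounds let $A_t=\lambda I+\sum_{s\le t}x_{a_s}x_{a_s}^\top$, $b_t=\sum_{s\le t}r_sx_{a_s}$, $\hat\theta_t=A_t^{-1}b_t$, and $$C_t=R\sqrt{2\log\frac{\kappa\,\det(A_t)^{1/2}\det(\lambda I)^{-1/2}}{\delta}}+\lambda^{1/2}S,\qquad \beta_t(i,j)=\sqrt{y(i,j)^\top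 A_t^{-1}y(i,j)}\;C_t,$$ where $\kappa=1$ or $\kappa=K^2$ (the statement holds for either choice). Choose $i_t\in\arg\max_i x_i^\top\hat\theta_t$ and $j_t\in\arg\max_j\bigl((x_j-x_{i_t})^\top\hat\theta_t+\beta_t(j,i_t)\bigr)$, and let $B(t)$ be the latter maximum. If $B(t)\le\varepsilon$, stop; otherwise pull $$a_{t+1}\in\arg\min_{a:\,p^*_a(y(i_t,j_t))>0}T_a(t)/p_a^*(y(i_t,j_t)),$$ where $T_a(t)$ is the number of pulls of arm $a$ in the first $t$ rounds. Ties are broken arbitrarily. Let $\tau=\inf\{t\ge K: B(t)\le\varepsilon\}$ be the stopping time. **Theorem.** 1. If $\lambda\le\frac{2R^2}{S^2}\log\frac{K^2}{\delta}$, then $$\mathbb{P}\Bigl[\tau\le 8H_\varepsilon R^2\log\tfrac{K^2}{\delta}+C(H_\varepsilon,\delta)\Bigr]\ge 1-\delta,$$ where $$C(H,\delta)=K+4HR^2d\log\Bigl(1+\frac{M^2L^2}{\lambda d}\Bigr),\quad M=2\sqrt{\frac{16H^2R^4dL^2}{\lambda}+N^2},\quad N=8HR^2\log\frac{K^2}{\delta}+K$$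 (the term in $C$ with the logarithm is read as $0$ if $d=0$). 2. $C(H,\delta)=\mathcal{O}\bigl(dH\log(dH\log\frac1\delta)\bigr)$ in the following uniform sense: for fixed $K,R,L$ and for all $h_0>0$, $\delta_0<1$, $\lambda_0>0$, $\eta>1$ there is a constant $c$ such that $C(H,\delta)\le c\,dH\log(dH\log\frac1\delta)$ for all $d\ge 1$, $H\ge h_0$, $0<\delta\le\delta_0$, $\lambda\ge\lambda_0$ with $dH\log\frac1\delta\ge\eta$. 3. If $\lambda>4H_\varepsilon R^2L^2$, then $$\mathbb{P}\Bigl[\tau\le 8H_\varepsilon R^2\log\tfrac{K^2}{\delta}+4H_\varepsilon\lambda S^2+2K\Bigr]\ge 1-\delta.$$ -/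

import Mathlib

open MeasureTheory

noncomputable section

namespace LinGapE

/-- The inputs of the algorithm: accuracy `eps`, confidence level `delta`, regularization `lam`,
noise level `R`, bound `S` on the norm of the unknown parameter, and the factor `kappa` that
stands in front of the determinant ratio inside the logarithm of the confidence radius. -/
structure Params where
  eps : ℝ
  delta : ℝ
  lam : ℝ
  R : ℝ
  S : ℝ
  kappa : ℝ

/-! ### Static quantities of the problem -/

section Static

variable {d K : ℕ} (x : Fin K → EuclideanSpace ℝ (Fin d)) (θ : EuclideanSpace ℝ (Fin d))

/-- The largest Euclidean norm of a feature vector. -/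
def maxNorm : ℝ := ⨆ i, ‖x i‖

/-- `w` solves the linear program: minimize `∑ |w k|` subject to `y = ∑ w k • x k`. -/
def IsL1Solution (y : EuclideanSpace ℝ (Fin d)) (w : Fin K → ℝ) : Prop :=
  y = ∑ k, w k • x k ∧
    ∀ v : Fin K → ℝ, y = ∑ k, v k • x k → ∑ k, |w k| ≤ ∑ k, |v k|

/-- The selection ratio `p*_k = |w_k| / ∑ |w_l|`. -/
def ratio (w : Fin K → ℝ) (k : Fin K) : ℝ := |w k| / ∑ l, |w l|

/-- The value `ρ = ∑ w_k² / p*_k = (∑ |w_k|)²`. -/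
def rho (w : Fin K → ℝ) : ℝ := (∑ k, |w k|) ^ 2

/-- The gap `Δ_i` with respect to the arm `best`; the gap of `best` itself is the smallest gap of
the other arms. -/
def gap (best i : Fin K) : ℝ :=
  if i = best then ⨅ j : {j : Fin K // j ≠ best}, inner ℝ (x best - x j) θ
  else inner ℝ (x best - x i) θ

/-- The problem complexity `H_ε`; `w y` is the chosen solution of the linear program for `y`. -/
def complexity (w : EuclideanSpace ℝ (Fin d) → Fin K → ℝ) (eps : ℝ) (best : Fin K) : ℝ :=
  ∑ k, ⨆ q : Fin K × Fin K,
    ratio (w (x q.1 - x q.2)) k * rho (w (x q.1 - x q.2)) /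
      (max eps (max ((eps + gap x θ best q.1) / 3) ((eps + gap x θ best q.2) / 3))) ^ 2

end Static

/-- `N = 8 H R² log (K² / δ) + K`. -/
def auxN (K : ℕ) (R H delta : ℝ) : ℝ :=
  8 * H * R ^ 2 * Real.log ((K : ℝ) ^ 2 / delta) + K

/-- `M = 2 √(16 H² R⁴ d L² / λ + N²)`. -/
def auxM (K d : ℕ) (R L lam H delta : ℝ) : ℝ :=
  2 * √(16 * H ^ 2 * R ^ 4 * d * L ^ 2 / lam + auxN K R H delta ^ 2)

/-- `C(H, δ) = K + 4 H R² d log (1 + M² L² / (λ d))`. -/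
def remainder (K d : ℕ) (R L lam H delta : ℝ) : ℝ :=
  K + 4 * H * R ^ 2 * d *
    Real.log (1 + auxM K d R L lam H delta ^ 2 * L ^ 2 / (lam * d))

/-! ### Quantities along one run

`a t` and `r t` are the arm pulled and the reward observed in round `t + 1`, so that the first `t`
rounds are the indices `s < t`. -/

section Path

variable {d K : ℕ} (x : Fin K → EuclideanSpace ℝ (Fin d)) (P : Params)
  (a : ℕ → Fin K) (r : ℕ → ℝ)

/-- `T_k(t)`: how often arm `k` was pulled in the first `t` rounds. -/
def pullCount (t : ℕ) (k : Fin K) : ℕ := ((Finset.range t).filter fun s => a s = k).card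

/-- `A_t = λ I + ∑_{s ≤ t} x_{a_s} x_{a_s}ᵀ`. -/
def designMatrix (t : ℕ) : Matrix (Fin d) (Fin d) ℝ :=
  P.lam • (1 : Matrix (Fin d) (Fin d) ℝ) +
    ∑ s ∈ Finset.range t, Matrix.vecMulVec (x (a s)).ofLp (x (a s)).ofLp

/-- `b_t = ∑_{s ≤ t} r_s x_{a_s}`. -/
def responseVec (t : ℕ) : EuclideanSpace ℝ (Fin d) := ∑ s ∈ Finset.range t, r s • x (a s)

/-- The regularized least-squares estimator `A_t⁻¹ b_t`. -/
def estimator (t : ℕ) : EuclideanSpace ℝ (Fin d) :=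
  WithLp.toLp 2 (Matrix.mulVec (designMatrix x P a t)⁻¹ (responseVec x a r t).ofLp)

/-- `‖y‖_M = √(yᵀ M y)`. -/
def matNorm (M : Matrix (Fin d) (Fin d) ℝ) (y : EuclideanSpace ℝ (Fin d)) : ℝ :=
  √(dotProduct y.ofLp (Matrix.mulVec M y.ofLp))

/-- The confidence radius `C_t`. -/
def confRadius (t : ℕ) : ℝ :=
  P.R * √(2 * Real.log (P.kappa * (designMatrix x P a t).det ^ (1 / 2 : ℝ) *
      (P.lam • (1 : Matrix (Fin d) (Fin d) ℝ)).det ^ (-(1 / 2) : ℝ) / P.delta)) +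
    P.lam ^ (1 / 2 : ℝ) * P.S

/-- The estimated gap of the arms `i` and `j`. -/
def estGap (t : ℕ) (i j : Fin K) : ℝ := inner ℝ (x i - x j) (estimator x P a r t)

/-- The confidence interval `β_t(i, j)`. -/
def confWidth (t : ℕ) (i j : Fin K) : ℝ :=
  matNorm (designMatrix x P a t)⁻¹ (x i - x j) * confRadius x P a t

/-- `B(t)`, for the sequence `i` of the estimated best arms. -/
def gapBound (i : ℕ → Fin K) (t : ℕ) : ℝ :=
  ⨆ j, (estGap x P a r t j (i t) + confWidth x P a t j (i t))

/-- The stopping time: the first `t ≥ K` with `B(t) ≤ ε` (`⊤` if there is none). -/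
def stopTime (i : ℕ → Fin K) : ℕ∞ :=
  sInf ((fun t : ℕ => (t : ℕ∞)) '' {t | K ≤ t ∧ gapBound x P a r i t ≤ P.eps})

/-- The arms `a` are pulled by the algorithm with the ratio rule when the rewards are `r`:
every arm is pulled once in the first `K` rounds; after `t ≥ K` rounds, `i t` is an arm with
the largest estimated reward, `j t` is a most ambiguous arm, and until the algorithm
stops, the next arm minimizes `T_k(t) / p*_k` over the arms with `p*_k > 0`, where `p*` is the
selection ratio for `x_{i_t} - x_{j_t}`. Ties may be broken in any way. -/
structure IsRatioRun (w : EuclideanSpace ℝ (Fin d) → Fin K → ℝ) (i j : ℕ → Fin K) : Prop where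
  init : ∀ (t : ℕ) (h : t < K), a t = ⟨t, h⟩
  best : ∀ t, K ≤ t → ∀ k,
    inner ℝ (x k) (estimator x P a r t) ≤ inner ℝ (x (i t)) (estimator x P a r t)
  ambiguous : ∀ t, K ≤ t → ∀ k,
    estGap x P a r t k (i t) + confWidth x P a t k (i t) ≤
      estGap x P a r t (j t) (i t) + confWidth x P a t (j t) (i t)
  ratio_pos : ∀ t : ℕ, K ≤ t → (t : ℕ∞) < stopTime x P a r i →
    0 < ratio (w (x (i t) - x (j t))) (a t)
  ratio_min : ∀ t : ℕ, K ≤ t → (t : ℕ∞) < stopTime x P a r i →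
    ∀ k, 0 < ratio (w (x (i t) - x (j t))) k →
      (pullCount a t (a t) : ℝ) / ratio (w (x (i t) - x (j t))) (a t) ≤
        (pullCount a t k : ℝ) / ratio (w (x (i t) - x (j t))) k

end Path

/-! ### The random run -/

section Random

variable {d K : ℕ} {Ω : Type*} [mΩ : MeasurableSpace Ω]

/-- `noise t`, the noise of round `t + 1`, is conditionally `R`-sub-Gaussian given the past
`ℱ t` (what is known before the reward of round `t + 1` is observed). -/
structure IsCondSubGaussian (μ : Measure Ω) (ℱ : Filtration ℕ mΩ) (R : ℝ)
    (noise : ℕ → Ω → ℝ) : Prop where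
  measurable : ∀ t, Measurable[ℱ (t + 1)] (noise t)
  integrable : ∀ (t : ℕ) (s : ℝ), Integrable (fun ω => Real.exp (s * noise t ω)) μ
  condExp_le : ∀ (t : ℕ) (s : ℝ),
    μ[fun ω => Real.exp (s * noise t ω) | ℱ t] ≤ᵐ[μ] fun _ => Real.exp (s ^ 2 * R ^ 2 / 2)

/-- The reward `x_{a}ᵀ θ + noise`. -/
def reward (x : Fin K → EuclideanSpace ℝ (Fin d)) (θ : EuclideanSpace ℝ (Fin d))
    (noise : ℕ → Ω → ℝ) (a : ℕ → Ω → Fin K) (ω : Ω) (t : ℕ) : ℝ :=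
  inner ℝ (x (a t ω)) θ + noise t ω

/-- The random arms `a` (with the random arms `i`, `j` of each round) are chosen by the algorithm
with the ratio rule, using only what is known before the reward is observed. -/
structure IsLinGapE (x : Fin K → EuclideanSpace ℝ (Fin d)) (θ : EuclideanSpace ℝ (Fin d))
    (P : Params) (w : EuclideanSpace ℝ (Fin d) → Fin K → ℝ) (ℱ : Filtration ℕ mΩ)
    (noise : ℕ → Ω → ℝ) (a i j : ℕ → Ω → Fin K) : Prop where
  arm_measurable : ∀ t, Measurable[ℱ t] (a t)
  best_measurable : ∀ t, Measurable[ℱ t] (i t)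
  ambiguous_measurable : ∀ t, Measurable[ℱ t] (j t)
  run : ∀ ω, IsRatioRun x P (fun t => a t ω) (reward x θ noise a ω) w
    (fun t => i t ω) (fun t => j t ω)

/-- The random number of pulls after which the algorithm stops. -/
def tau (x : Fin K → EuclideanSpace ℝ (Fin d)) (θ : EuclideanSpace ℝ (Fin d))
    (P : Params) (noise : ℕ → Ω → ℝ) (a i : ℕ → Ω → Fin K) (ω : Ω) : ℕ∞ :=
  stopTime x P (fun t => a t ω) (reward x θ noise a ω) (fun t => i t ω)

end Random

end LinGapE

end

/-! The proof splits into one probabilistic event and a deterministic count on that event.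

Event: with probability at least 1 - δ all confidence intervals are valid at all times
(`one_sub_le_measureReal_isConfident`). For R > 0 rescale the noise e to R = 1. Then √(det(λI)/det
A_t) · exp(½‖∑ e_s x_{a_s}‖²), with the norm given by A_t⁻¹, is a supermartingale: each round
multiplies it by the average of exp(g e - g²/2) over a Gaussian g whose mean and variance are known
before the reward (`lintegral_mul_mixtureFactor_le`). Ville's inequality keeps it below 1/δ for all
times at once, outside an event of probability at most δ.

Count: while the algorithm runs, the width of the compared pair is at least the threshold in the
denominator of H_ε (`threshold_le_confWidth`). Cauchy–Schwarz with the weights w* and the ratio rule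
bound the squared width by p*_a ρ C_t² / T_a(t), where a is the arm about to be pulled. Hence T_a(t)
is at most the a-th summand of H_ε times C_t² (`pullCount_le_of_lt_stopTime`), and summing over the
arms gives n ≤ K + H_ε max C_t² for every n ≤ τ (`natCast_le_of_le_stopTime`). The determinant–trace
inequality makes C_t² at most logarithmic in n, and the implicit inequality is solved for n: for
small λ through log(1 + z) ≤ 2√z, for large λ by absorbing n/2 on the left. -/

open scoped Matrix

noncomputable section

namespace LinGapE

/-! ### Rank-one updates and the norm of an inverse positive definite matrix -/

section LinearAlgebra

variable {d : ℕ} {A : Matrix (Fin d) (Fin d) ℝ}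

lemma dotProduct_inv_mulVec_comm (hA : A.PosDef) (x y : Fin d → ℝ) :
    x ⬝ᵥ A⁻¹ *ᵥ y = y ⬝ᵥ A⁻¹ *ᵥ x := by
  have h : (A⁻¹)ᵀ = A⁻¹ := by
    have := hA.inv.isHermitian
    rwa [Matrix.IsHermitian, Matrix.conjTranspose_eq_transpose_of_trivial] at this
  rw [Matrix.dotProduct_mulVec, ← Matrix.mulVec_transpose, h, dotProduct_comm]

lemma dotProduct_inv_mulVec_nonneg (hA : A.PosDef) (x : Fin d → ℝ) :
    0 ≤ x ⬝ᵥ A⁻¹ *ᵥ x := by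
  simpa using hA.inv.posSemidef.dotProduct_mulVec_nonneg x

lemma dotProduct_inv_mulVec_eq_zero (hA : A.PosDef) {x : Fin d → ℝ}
    (h : x ⬝ᵥ A⁻¹ *ᵥ x = 0) : x = 0 := by
  by_contra hx
  have := hA.inv.dotProduct_mulVec_pos hx
  simp only [star_trivial] at this
  linarith

lemma det_add_vecMulVec_self (hA : A.PosDef) (x : Fin d → ℝ) :
    (A + Matrix.vecMulVec x x).det = A.det * (1 + x ⬝ᵥ A⁻¹ *ᵥ x) := by
  rw [Matrix.vecMulVec_eq Unit, Matrix.det_add_replicateCol_mul_replicateRow hA.det_pos.ne'.isUnit]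
  congr 1
  rw [Matrix.mul_assoc, Matrix.det_unique]
  simp [Matrix.mul_apply, Matrix.mulVec, dotProduct]

lemma posDef_add_vecMulVec_self (hA : A.PosDef) (x : Fin d → ℝ) :
    (A + Matrix.vecMulVec x x).PosDef := by
  have := Matrix.posSemidef_vecMulVec_self_star x
  rw [star_trivial] at this
  exact hA.add_posSemidef this

lemma mulVec_inv_mulVec (hA : A.PosDef) (z : Fin d → ℝ) : A *ᵥ (A⁻¹ *ᵥ z) = z := by
  rw [Matrix.mulVec_mulVec, Matrix.mul_nonsing_inv _ hA.det_pos.ne'.isUnit, Matrix.one_mulVec]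

lemma inv_mulVec_mulVec (hA : A.PosDef) (z : Fin d → ℝ) : A⁻¹ *ᵥ (A *ᵥ z) = z := by
  rw [Matrix.mulVec_mulVec, Matrix.nonsing_inv_mul _ hA.det_pos.ne'.isUnit, Matrix.one_mulVec]

/-- The Sherman–Morrison formula for a symmetric rank-one update. -/
lemma inv_add_vecMulVec_self_mulVec (hA : A.PosDef) (x z : Fin d → ℝ) :
    (A + Matrix.vecMulVec x x)⁻¹ *ᵥ z =
      A⁻¹ *ᵥ z - (x ⬝ᵥ A⁻¹ *ᵥ z / (1 + x ⬝ᵥ A⁻¹ *ᵥ x)) • A⁻¹ *ᵥ x := by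
  have hu : 1 + x ⬝ᵥ A⁻¹ *ᵥ x ≠ 0 := by linarith [dotProduct_inv_mulVec_nonneg hA x]
  have key : (A + Matrix.vecMulVec x x) *ᵥ
      (A⁻¹ *ᵥ z - (x ⬝ᵥ A⁻¹ *ᵥ z / (1 + x ⬝ᵥ A⁻¹ *ᵥ x)) • A⁻¹ *ᵥ x) = z := by
    rw [Matrix.add_mulVec, Matrix.mulVec_sub, Matrix.mulVec_sub, Matrix.mulVec_smul,
      Matrix.mulVec_smul, mulVec_inv_mulVec hA, mulVec_inv_mulVec hA, Matrix.vecMulVec_mulVec,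
      Matrix.vecMulVec_mulVec]
    ext i
    simp only [Pi.add_apply, Pi.sub_apply, Pi.smul_apply, smul_eq_mul, MulOpposite.smul_eq_mul_unop,
      MulOpposite.unop_op]
    field_simp
    ring
  conv_lhs => rw [← key]
  rw [inv_mulVec_mulVec (posDef_add_vecMulVec_self hA x)]

/-- Half of the increment is the exponent of `mixtureFactor u v e` with u = xᵀA⁻¹x and v = xᵀA⁻¹z,
which makes the recursion for `selfNormalizedExp` exact. -/
lemma quadForm_inv_add_vecMulVec_self (hA : A.PosDef) (x z : Fin d → ℝ) (e : ℝ) :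
    (z + e • x) ⬝ᵥ (A + Matrix.vecMulVec x x)⁻¹ *ᵥ (z + e • x) =
      z ⬝ᵥ A⁻¹ *ᵥ z + ((x ⬝ᵥ A⁻¹ *ᵥ x) * e ^ 2 + 2 * (x ⬝ᵥ A⁻¹ *ᵥ z) * e -
        (x ⬝ᵥ A⁻¹ *ᵥ z) ^ 2) / (1 + x ⬝ᵥ A⁻¹ *ᵥ x) := by
  have hu : 1 + x ⬝ᵥ A⁻¹ *ᵥ x ≠ 0 := by linarith [dotProduct_inv_mulVec_nonneg hA x]
  rw [inv_add_vecMulVec_self_mulVec hA]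
  simp only [Matrix.mulVec_add, Matrix.mulVec_smul, dotProduct_add, dotProduct_sub, add_dotProduct,
    smul_dotProduct, dotProduct_smul, smul_eq_mul, dotProduct_inv_mulVec_comm hA z x]
  field_simp
  ring

/-- Cauchy–Schwarz for the inner product given by the inverse of a positive definite matrix. -/
lemma abs_dotProduct_inv_mulVec_le (hA : A.PosDef) (x y : Fin d → ℝ) :
    |x ⬝ᵥ A⁻¹ *ᵥ y| ≤ √(x ⬝ᵥ A⁻¹ *ᵥ x) * √(y ⬝ᵥ A⁻¹ *ᵥ y) := by
  rw [← Real.sqrt_mul (dotProduct_inv_mulVec_nonneg hA x)]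
  apply Real.abs_le_sqrt
  have h := discrim_le_zero (a := x ⬝ᵥ A⁻¹ *ᵥ x) (b := 2 * (x ⬝ᵥ A⁻¹ *ᵥ y))
    (c := y ⬝ᵥ A⁻¹ *ᵥ y) (fun t => by
      have := dotProduct_inv_mulVec_nonneg hA (t • x + y)
      simp only [Matrix.mulVec_add, Matrix.mulVec_smul, dotProduct_add, add_dotProduct,
        smul_dotProduct, dotProduct_smul, smul_eq_mul, dotProduct_inv_mulVec_comm hA y x] at this
      linarith)
  rw [discrim] at h
  linarith

/-- The Minkowski inequality for the norm given by the inverse of a positive definite matrix. -/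
lemma abs_dotProduct_inv_mulVec_sub_le (hA : A.PosDef) (y s q : Fin d → ℝ) :
    |y ⬝ᵥ A⁻¹ *ᵥ (s - q)| ≤
      √(y ⬝ᵥ A⁻¹ *ᵥ y) * (√(s ⬝ᵥ A⁻¹ *ᵥ s) + √(q ⬝ᵥ A⁻¹ *ᵥ q)) := by
  rw [Matrix.mulVec_sub, dotProduct_sub, mul_add]
  exact (abs_sub _ _).trans
    (add_le_add (abs_dotProduct_inv_mulVec_le hA y s) (abs_dotProduct_inv_mulVec_le hA y q))

/-- `log det` is at most the dimension times the logarithm of the average eigenvalue. -/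
lemma log_det_le (hA : A.PosDef) :
    Real.log A.det ≤ d * Real.log (A.trace / d) := by
  rcases Nat.eq_zero_or_pos d with rfl | hd
  · simp
  have hd' : (0 : ℝ) < d := by exact_mod_cast hd
  have hpos := hA.eigenvalues_pos
  have htr : A.trace = ∑ i, hA.isHermitian.eigenvalues i := by
    simpa using hA.isHermitian.trace_eq_sum_eigenvalues
  have hdet : A.det = ∏ i, hA.isHermitian.eigenvalues i := by
    simpa using hA.isHermitian.det_eq_prod_eigenvalues
  have : Nonempty (Fin d) := ⟨⟨0, hd⟩⟩
  have htpos : 0 < A.trace := by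
    rw [htr]; exact Finset.sum_pos (fun i _ => hpos i) Finset.univ_nonempty
  set m := A.trace / d with hm
  have hmpos : 0 < m := div_pos htpos hd'
  rw [hdet, Real.log_prod (fun i _ => (hpos i).ne')]
  -- Tangent of log at the mean eigenvalue m; the linear terms sum to zero.
  calc ∑ i, Real.log (hA.isHermitian.eigenvalues i)
      ≤ ∑ i, (Real.log m + (hA.isHermitian.eigenvalues i / m - 1)) := by
        apply Finset.sum_le_sum
        intro i _
        have := Real.log_le_sub_one_of_pos (div_pos (hpos i) hmpos)
        rw [Real.log_div (hpos i).ne' hmpos.ne'] at this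
        linarith
    _ = d * Real.log m := by
        rw [Finset.sum_add_distrib, Finset.sum_sub_distrib, ← Finset.sum_div, ← htr]
        have : A.trace / m = d := by rw [hm]; field_simp
        simp [this]

end LinearAlgebra

/-! ### The design matrix: determinant growth and width of a combination of arms -/

section Design

variable {d K : ℕ} (x : Fin K → EuclideanSpace ℝ (Fin d)) {P : Params} (a : ℕ → Fin K)

lemma designMatrix_succ (P : Params) (t : ℕ) : designMatrix x P a (t + 1) =
    designMatrix x P a t + Matrix.vecMulVec (x (a t)).ofLp (x (a t)).ofLp := by
  simp [designMatrix, Finset.sum_range_succ, add_assoc]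

lemma designMatrix_posDef (hlam : 0 < P.lam) (t : ℕ) : (designMatrix x P a t).PosDef := by
  induction t with
  | zero => simpa [designMatrix] using Matrix.PosDef.one.smul hlam
  | succ t ih => rw [designMatrix_succ]; exact posDef_add_vecMulVec_self ih _

lemma dotProduct_ofLp {n : ℕ} (u v : EuclideanSpace ℝ (Fin n)) :
    u.ofLp ⬝ᵥ v.ofLp = inner ℝ u v := by
  simp [PiLp.inner_apply, dotProduct, mul_comm]

lemma norm_le_maxNorm (k : Fin K) : ‖x k‖ ≤ maxNorm x :=
  le_ciSup (Set.finite_range fun i => ‖x i‖).bddAbove k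

lemma trace_designMatrix_le (P : Params) (t : ℕ) :
    (designMatrix x P a t).trace ≤ d * P.lam + t * maxNorm x ^ 2 := by
  induction t with
  | zero => simp [designMatrix, mul_comm]
  | succ t ih =>
    rw [designMatrix_succ, Matrix.trace_add, Matrix.trace_vecMulVec, dotProduct_ofLp,
      real_inner_self_eq_norm_sq]
    have : ‖x (a t)‖ ^ 2 ≤ maxNorm x ^ 2 :=
      pow_le_pow_left₀ (norm_nonneg _) (norm_le_maxNorm x _) 2
    push_cast
    linarith

lemma det_smul_one_pos (hlam : 0 < P.lam) :
    0 < (P.lam • (1 : Matrix (Fin d) (Fin d) ℝ)).det := by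
  simp [hlam]

/-- The determinant–trace inequality. -/
lemma log_det_designMatrix_sub_le (hlam : 0 < P.lam) (t : ℕ) :
    Real.log (designMatrix x P a t).det -
        Real.log (P.lam • (1 : Matrix (Fin d) (Fin d) ℝ)).det ≤
      d * Real.log (1 + t * maxNorm x ^ 2 / (P.lam * d)) := by
  rcases Nat.eq_zero_or_pos d with rfl | hd
  · simp
  have hd' : (0 : ℝ) < d := by exact_mod_cast hd
  have hA := designMatrix_posDef x a hlam t
  have : Nonempty (Fin d) := ⟨⟨0, hd⟩⟩
  have h1 := log_det_le hA
  have h2 : Real.log ((designMatrix x P a t).trace / d) ≤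
      Real.log (P.lam * (1 + t * maxNorm x ^ 2 / (P.lam * d))) := by
    apply Real.log_le_log (div_pos hA.trace_pos hd')
    rw [div_le_iff₀ hd']
    have := trace_designMatrix_le x a P t
    field_simp
    linarith
  rw [Real.log_mul hlam.ne' (by positivity)] at h2
  have h3 : Real.log (P.lam • (1 : Matrix (Fin d) (Fin d) ℝ)).det = d * Real.log P.lam := by
    simp
  have := mul_le_mul_of_nonneg_left h2 hd'.le
  rw [h3]
  linarith

lemma pullCount_succ (a : ℕ → Fin K) (t : ℕ) (k : Fin K) :
    pullCount a (t + 1) k = pullCount a t k + if a t = k then 1 else 0 := by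
  rw [pullCount, Finset.range_add_one, Finset.filter_insert]
  split_ifs with h <;> simp [pullCount]

/-- The quadratic form of the design matrix dominates that of the pulled arms. -/
lemma sum_pullCount_mul_sq_le (hlam : 0 < P.lam) (t : ℕ) (z : Fin d → ℝ) :
    ∑ k, (pullCount a t k : ℝ) * ((x k).ofLp ⬝ᵥ z) ^ 2 ≤ z ⬝ᵥ designMatrix x P a t *ᵥ z := by
  induction t with
  | zero =>
    have := (designMatrix_posDef x a hlam 0).posSemidef.dotProduct_mulVec_nonneg z
    simpa [pullCount] using this
  | succ t ih =>
    rw [designMatrix_succ, Matrix.add_mulVec, dotProduct_add, Matrix.vecMulVec_mulVec]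
    simp only [pullCount_succ, Nat.cast_add, Nat.cast_ite, Nat.cast_one, Nat.cast_zero, add_mul,
      Finset.sum_add_distrib, ite_mul, one_mul, zero_mul, Finset.sum_ite_eq,
      Finset.mem_univ, if_true]
    have h2 : z ⬝ᵥ MulOpposite.op ((x (a t)).ofLp ⬝ᵥ z) • (x (a t)).ofLp =
        ((x (a t)).ofLp ⬝ᵥ z) ^ 2 := by
      rw [dotProduct_smul, dotProduct_comm z, MulOpposite.smul_eq_mul_unop, MulOpposite.unop_op, sq]
    rw [h2]
    linarith

/-- The squared confidence norm of a combination of the arms. -/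
lemma matNorm_sq_le (hlam : 0 < P.lam) (t : ℕ) (y : EuclideanSpace ℝ (Fin d)) (w : Fin K → ℝ)
    (hy : y = ∑ k, w k • x k) (hT : ∀ k, w k ≠ 0 → 0 < pullCount a t k) :
    matNorm (designMatrix x P a t)⁻¹ y ^ 2 ≤ ∑ k, w k ^ 2 / pullCount a t k := by
  have hA := designMatrix_posDef x a hlam t
  have h0 := dotProduct_inv_mulVec_nonneg hA y.ofLp
  rw [matNorm, Real.sq_sqrt h0]
  set z := (designMatrix x P a t)⁻¹ *ᵥ y.ofLp with hz
  have hq : y.ofLp ⬝ᵥ z = z ⬝ᵥ designMatrix x P a t *ᵥ z := by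
    rw [hz, mulVec_inv_mulVec hA, dotProduct_comm]
  have hsum : y.ofLp ⬝ᵥ z = ∑ k, w k * ((x k).ofLp ⬝ᵥ z) := by
    rw [hy]
    simp [WithLp.ofLp_sum, sum_dotProduct, smul_dotProduct]
  -- Cauchy–Schwarz with weights T_k. Since z = A_t⁻¹y, the second factor is at most zᵀA_t z = yᵀz,
  -- so one power of yᵀz cancels at the end.
  have hcs : (y.ofLp ⬝ᵥ z) ^ 2 ≤
      (∑ k, w k ^ 2 / pullCount a t k) * ∑ k, (pullCount a t k : ℝ) * ((x k).ofLp ⬝ᵥ z) ^ 2 := by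
    rw [hsum]
    apply Finset.sum_sq_le_sum_mul_sum_of_sq_le_mul
    · intro k _; positivity
    · intro k _; positivity
    · intro k _
      by_cases hk : w k = 0
      · simp [hk]
      · have : (pullCount a t k : ℝ) ≠ 0 := by exact_mod_cast (hT k hk).ne'
        apply le_of_eq
        field_simp
  have h1 := sum_pullCount_mul_sq_le x a hlam t z
  rw [← hq] at h1
  have h2 : (y.ofLp ⬝ᵥ z) ^ 2 ≤ (∑ k, w k ^ 2 / pullCount a t k) * (y.ofLp ⬝ᵥ z) :=
    hcs.trans (mul_le_mul_of_nonneg_left h1 (by positivity))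
  rcases h0.eq_or_lt with h | h
  · rw [← h]; positivity
  · rw [sq] at h2; exact le_of_mul_le_mul_right h2 h

end Design

/-! ### Counting pulls on the event that the confidence intervals are valid -/

section Counting

variable {d K : ℕ} {x : Fin K → EuclideanSpace ℝ (Fin d)} {θ : EuclideanSpace ℝ (Fin d)}
  {P : Params} {a : ℕ → Fin K} {r : ℕ → ℝ} {best : Fin K}
  {w : EuclideanSpace ℝ (Fin d) → Fin K → ℝ} {i j : ℕ → Fin K}

/-- The accuracy that has to be reached for the pair `(i, j)`. -/
def threshold (x : Fin K → EuclideanSpace ℝ (Fin d)) (θ : EuclideanSpace ℝ (Fin d)) (eps : ℝ)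
    (best i j : Fin K) : ℝ :=
  max eps (max ((eps + gap x θ best i) / 3) ((eps + gap x θ best j) / 3))

/-- The summand of the complexity that belongs to the arm `k`. -/
def armComplexity (x : Fin K → EuclideanSpace ℝ (Fin d)) (θ : EuclideanSpace ℝ (Fin d))
    (w : EuclideanSpace ℝ (Fin d) → Fin K → ℝ) (eps : ℝ) (best k : Fin K) : ℝ :=
  ⨆ q : Fin K × Fin K, ratio (w (x q.1 - x q.2)) k * rho (w (x q.1 - x q.2)) /
    threshold x θ eps best q.1 q.2 ^ 2

/-- All confidence intervals contain the true differences of the rewards. -/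
def IsConfident (x : Fin K → EuclideanSpace ℝ (Fin d)) (θ : EuclideanSpace ℝ (Fin d))
    (P : Params) (a : ℕ → Fin K) (r : ℕ → ℝ) : Prop :=
  ∀ t k l, |estGap x P a r t k l - inner ℝ (x k - x l) θ| ≤ confWidth x P a t k l

lemma complexity_eq_sum (eps : ℝ) :
    complexity x θ w eps best = ∑ k, armComplexity x θ w eps best k := rfl

lemma ratio_nonneg (v : Fin K → ℝ) (k : Fin K) : 0 ≤ ratio v k :=
  div_nonneg (abs_nonneg _) (Finset.sum_nonneg fun _ _ => abs_nonneg _)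

lemma rho_nonneg (v : Fin K → ℝ) : 0 ≤ rho v := sq_nonneg _

lemma armComplexity_nonneg (eps : ℝ) (k : Fin K) : 0 ≤ armComplexity x θ w eps best k :=
  Real.iSup_nonneg fun _ => div_nonneg (mul_nonneg (ratio_nonneg _ _) (rho_nonneg _)) (sq_nonneg _)

lemma complexity_nonneg (eps : ℝ) : 0 ≤ complexity x θ w eps best :=
  Finset.sum_nonneg fun k _ => armComplexity_nonneg eps k

lemma le_armComplexity (eps : ℝ) (k i j : Fin K) :
    ratio (w (x i - x j)) k * rho (w (x i - x j)) / threshold x θ eps best i j ^ 2 ≤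
      armComplexity x θ w eps best k :=
  le_ciSup (Set.finite_range fun q : Fin K × Fin K => ratio (w (x q.1 - x q.2)) k *
    rho (w (x q.1 - x q.2)) / threshold x θ eps best q.1 q.2 ^ 2).bddAbove (i, j)

lemma gap_of_ne {k : Fin K} (h : k ≠ best) : gap x θ best k = inner ℝ (x best - x k) θ := by
  simp [gap, h]

lemma gap_best_le {k : Fin K} (h : k ≠ best) : gap x θ best best ≤ gap x θ best k := by
  rw [gap_of_ne h, gap, if_pos rfl]
  exact ciInf_le (Set.finite_range fun l : {l : Fin K // l ≠ best} =>
    inner ℝ (x best - x l) θ).bddBelow ⟨k, h⟩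

lemma gap_nonneg (hbest : ∀ k, inner ℝ (x k) θ ≤ inner ℝ (x best) θ) (k : Fin K) :
    0 ≤ gap x θ best k := by
  have h : ∀ l, 0 ≤ inner ℝ (x best - x l) θ := fun l => by
    rw [inner_sub_left]; linarith [hbest l]
  unfold gap
  split_ifs
  -- For K = 1 the infimum runs over an empty type and is 0 by convention.
  · exact Real.iInf_nonneg fun l => h l
  · exact h k

/-- Of two distinct arms one is not `best`; if ε = 0, uniqueness of the best arm makes its gap
positive. -/
lemma threshold_pos (heps : 0 ≤ P.eps)
    (hfin : 0 < P.eps ∨ ∀ k, k ≠ best → inner ℝ (x k) θ < inner ℝ (x best) θ)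
    {k l : Fin K} (hkl : k ≠ l) : 0 < threshold x θ P.eps best k l := by
  rcases hfin with h | h
  · exact lt_of_lt_of_le h (le_max_left _ _)
  have hg : ∀ m, m ≠ best → 0 < (P.eps + gap x θ best m) / 3 := fun m hm => by
    rw [gap_of_ne hm, inner_sub_left]; linarith [h m hm]
  by_cases hk : k = best
  · exact lt_of_lt_of_le (hg l fun hl => hkl (hk.trans hl.symm))
      ((le_max_right _ _).trans (le_max_right _ _))
  · exact lt_of_lt_of_le (hg k hk) ((le_max_left _ _).trans (le_max_right _ _))

lemma eps_lt_gapBound {t : ℕ} (hK : K ≤ t) (h : (t : ℕ∞) < stopTime x P a r i) :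
    P.eps < gapBound x P a r i t := by
  by_contra! hle
  have h' : stopTime x P a r i ≤ t := sInf_le ⟨t, ⟨hK, hle⟩, rfl⟩
  exact absurd h (not_lt.2 h')

lemma gapBound_eq (hrun : IsRatioRun x P a r w i j) {t : ℕ} (hK : K ≤ t) :
    gapBound x P a r i t = estGap x P a r t (j t) (i t) + confWidth x P a t (j t) (i t) := by
  have : Nonempty (Fin K) := ⟨i t⟩
  exact le_antisymm (ciSup_le (hrun.ambiguous t hK))
    (le_ciSup (Set.finite_range fun k =>
      estGap x P a r t k (i t) + confWidth x P a t k (i t)).bddAbove (j t))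

lemma matNorm_neg (M : Matrix (Fin d) (Fin d) ℝ) (y : EuclideanSpace ℝ (Fin d)) :
    matNorm M (-y) = matNorm M y := by
  simp [matNorm, Matrix.mulVec_neg]

lemma confWidth_comm (t : ℕ) (k l : Fin K) :
    confWidth x P a t k l = confWidth x P a t l k := by
  rw [confWidth, confWidth, ← neg_sub, matNorm_neg]

lemma confWidth_self (t : ℕ) (k : Fin K) : confWidth x P a t k k = 0 := by
  simp [confWidth, matNorm]

lemma estGap_self (t : ℕ) (k : Fin K) : estGap x P a r t k k = 0 := by
  simp [estGap]

/-- If the two arms agreed, estimated gap and width would vanish, so B(t) = 0 ≤ ε and the algorithm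
would have stopped. -/
lemma ne_of_lt_stopTime (heps : 0 ≤ P.eps) (hrun : IsRatioRun x P a r w i j) {t : ℕ}
    (hK : K ≤ t) (h : (t : ℕ∞) < stopTime x P a r i) : i t ≠ j t := by
  intro hij
  have h1 := eps_lt_gapBound hK h
  rw [gapBound_eq hrun hK, hij, confWidth_self, estGap_self] at h1
  linarith

/-- Before the algorithm stops, the confidence width of the compared pair is large. -/
lemma threshold_le_confWidth (heps : 0 ≤ P.eps)
    (hbest : ∀ k, inner ℝ (x k) θ ≤ inner ℝ (x best) θ)
    (hconf : IsConfident x θ P a r) (hrun : IsRatioRun x P a r w i j) {t : ℕ}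
    (hK : K ≤ t) (h : (t : ℕ∞) < stopTime x P a r i) :
    threshold x θ P.eps best (i t) (j t) ≤ confWidth x P a t (i t) (j t) := by
  have hij := ne_of_lt_stopTime heps hrun hK h
  have hB := eps_lt_gapBound hK h
  have hBeq := gapBound_eq hrun hK
  have hamb := hrun.ambiguous t hK best
  have hmax := hrun.best t hK (j t)
  have hc1 := (abs_le.1 (hconf t (j t) (i t)))
  have hc2 := (abs_le.1 (hconf t best (i t)))
  have hji : estGap x P a r t (j t) (i t) ≤ 0 := by
    rw [estGap, inner_sub_left]; linarith
  rw [← hBeq] at hamb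
  rw [confWidth_comm] at hBeq hc1
  have hin : inner ℝ (x (j t) - x (i t)) θ =
      inner ℝ (x best - x (i t)) θ - inner ℝ (x best - x (j t)) θ := by
    simp only [inner_sub_left]; ring
  have hgi0 := gap_nonneg hbest (i t)
  have hgj0 := gap_nonneg hbest (j t)
  -- Let β be the width of the pair. As i_t maximizes the estimate, β ≥ B(t) > ε. Maximality of
  -- B(t), tested on `best`, gives (x_best - x_{i_t})ᵀθ ≤ B(t) ≤ β. Validity for (j_t, i_t) costs 2β
  -- more for j_t and gains ε, whence the factor 3. If one arm is `best`, its gap is at most that of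
  -- the other.
  have key : gap x θ best (i t) + P.eps ≤ 3 * confWidth x P a t (i t) (j t) ∧
      gap x θ best (j t) + P.eps ≤ 3 * confWidth x P a t (i t) (j t) := by
    by_cases hib : i t = best
    · have hjb : j t ≠ best := fun hj => hij (hib.trans hj.symm)
      have h1 := gap_best_le (x := x) (θ := θ) hjb
      have h2 := gap_of_ne (x := x) (θ := θ) hjb
      have h3 : inner ℝ (x best - x (i t)) θ = 0 := by rw [hib]; simp
      have h4 : gap x θ best (i t) = gap x θ best best := by rw [hib]
      constructor <;> linarith
    · have h2 := gap_of_ne (x := x) (θ := θ) hib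
      by_cases hjb : j t = best
      · have h1 := gap_best_le (x := x) (θ := θ) hib
        have h3 : inner ℝ (x best - x (j t)) θ = 0 := by rw [hjb]; simp
        have h4 : gap x θ best (j t) = gap x θ best best := by rw [hjb]
        constructor <;> linarith
      · have h3 := gap_of_ne (x := x) (θ := θ) hjb
        constructor <;> linarith
  refine max_le (by linarith) (max_le ?_ ?_)
  · linarith [key.1]
  · linarith [key.2]

lemma sum_pullCount (a : ℕ → Fin K) (t : ℕ) : ∑ k, pullCount a t k = t := by
  unfold pullCount
  rw [Finset.sum_card_fiberwise_eq_card_filter]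
  simp

lemma pullCount_mono (a : ℕ → Fin K) (k : Fin K) : Monotone fun t => pullCount a t k :=
  monotone_nat_of_le_succ fun t => by rw [pullCount_succ]; omega

lemma pullCount_init (hrun : IsRatioRun x P a r w i j) (k : Fin K) : pullCount a K k = 1 := by
  rw [pullCount, Finset.card_eq_one]
  refine ⟨k, ?_⟩
  ext s
  simp only [Finset.mem_filter, Finset.mem_range, Finset.mem_singleton]
  constructor
  · rintro ⟨hs, h⟩
    rw [hrun.init s hs] at h
    rw [← h]
  · rintro rfl
    exact ⟨k.2, by rw [hrun.init k k.2]⟩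

/-- The arm that the ratio rule selects has not been pulled too often yet. -/
lemma pullCount_le_of_lt_stopTime (heps : 0 ≤ P.eps) (hlam : 0 < P.lam)
    (hbest : ∀ k, inner ℝ (x k) θ ≤ inner ℝ (x best) θ)
    (hfin : 0 < P.eps ∨ ∀ k, k ≠ best → inner ℝ (x k) θ < inner ℝ (x best) θ)
    (hw : ∀ k l, IsL1Solution x (x k - x l) (w (x k - x l)))
    (hconf : IsConfident x θ P a r) (hrun : IsRatioRun x P a r w i j) {t : ℕ}
    (hK : K ≤ t) (h : (t : ℕ∞) < stopTime x P a r i) :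
    (pullCount a t (a t) : ℝ) ≤
      armComplexity x θ w P.eps best (a t) * confRadius x P a t ^ 2 := by
  have hD := threshold_pos (P := P) heps hfin (ne_of_lt_stopTime heps hrun hK h)
  have hDle := threshold_le_confWidth heps hbest hconf hrun hK h
  have hT : ∀ k, 0 < pullCount a t k := fun k => by
    have := pullCount_mono a k hK
    simp only [pullCount_init hrun] at this
    omega
  set y := x (i t) - x (j t) with hy
  set D := threshold x θ P.eps best (i t) (j t)
  set p := ratio (w y) (a t) with hp
  have hp0 : 0 < p := hrun.ratio_pos t hK h
  have hT0 : (0 : ℝ) < pullCount a t (a t) := by exact_mod_cast hT _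
  -- A zero total weight would make every ratio 0, because x / 0 = 0.
  have hS : 0 < ∑ l, |w y l| := by
    by_contra hle
    have : ∑ l, |w y l| = 0 :=
      le_antisymm (not_lt.1 hle) (Finset.sum_nonneg fun _ _ => abs_nonneg _)
    simp [hp, ratio, this] at hp0
  have hnorm := matNorm_sq_le x a hlam t y (w y) (hw _ _).1 fun k _ => hT k
  -- With S = ∑ |w_l|, the rule T_a/p_a ≤ T_k/p_k turns each term into at most |w_k| S p_a/T_a; the
  -- sum over k supplies the second factor S of ρ = S².
  have hsum : ∑ k, w y k ^ 2 / (pullCount a t k : ℝ) ≤ p * rho (w y) / pullCount a t (a t) := by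
    have : ∀ k, w y k ^ 2 / (pullCount a t k : ℝ) ≤
        |w y k| * ((∑ l, |w y l|) * (p / pullCount a t (a t))) := by
      intro k
      rcases eq_or_ne (w y k) 0 with hk | hk
      · simp [hk]
      have hpk : 0 < ratio (w y) k := div_pos (abs_pos.2 hk) hS
      have hmin := hrun.ratio_min t hK h k hpk
      rw [div_le_div_iff₀ hp0 hpk] at hmin
      have hTk : (0 : ℝ) < pullCount a t k := by exact_mod_cast hT k
      have hwk : |w y k| = ratio (w y) k * ∑ l, |w y l| := by
        rw [ratio, div_mul_cancel₀ _ hS.ne']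
      rw [div_le_iff₀ hTk, ← sq_abs, sq, mul_assoc |w y k|]
      apply mul_le_mul_of_nonneg_left _ (abs_nonneg _)
      calc |w y k| = (∑ l, |w y l|) * ratio (w y) k := by rw [hwk, mul_comm]
        _ ≤ (∑ l, |w y l|) * (p / pullCount a t (a t) * pullCount a t k) := by
          apply mul_le_mul_of_nonneg_left _ hS.le
          rw [div_mul_eq_mul_div, le_div_iff₀ hT0]
          linarith
        _ = _ := by ring
    calc _ ≤ ∑ k, |w y k| * ((∑ l, |w y l|) * (p / pullCount a t (a t))) :=
          Finset.sum_le_sum fun k _ => this k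
      _ = _ := by rw [← Finset.sum_mul, rho]; ring
  have hsq : D ^ 2 ≤ p * rho (w y) / pullCount a t (a t) * confRadius x P a t ^ 2 :=
    calc D ^ 2 ≤ confWidth x P a t (i t) (j t) ^ 2 := pow_le_pow_left₀ hD.le hDle 2
      _ = matNorm (designMatrix x P a t)⁻¹ y ^ 2 * confRadius x P a t ^ 2 := by
        rw [confWidth, mul_pow]
      _ ≤ _ := mul_le_mul_of_nonneg_right (hnorm.trans hsum) (sq_nonneg _)
  calc (pullCount a t (a t) : ℝ) ≤ p * rho (w y) / D ^ 2 * confRadius x P a t ^ 2 := by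
        rw [div_mul_eq_mul_div, le_div_iff₀ (pow_pos hD 2)]
        rw [div_mul_eq_mul_div, le_div_iff₀ hT0] at hsq
        linarith
    _ ≤ _ := mul_le_mul_of_nonneg_right (le_armComplexity _ _ _ _) (sq_nonneg _)

/-- As long as the algorithm runs, the number of rounds is controlled by the complexity and the
confidence radius. -/
lemma natCast_le_of_le_stopTime (heps : 0 ≤ P.eps) (hlam : 0 < P.lam)
    (hbest : ∀ k, inner ℝ (x k) θ ≤ inner ℝ (x best) θ)
    (hfin : 0 < P.eps ∨ ∀ k, k ≠ best → inner ℝ (x k) θ < inner ℝ (x best) θ)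
    (hw : ∀ k l, IsL1Solution x (x k - x l) (w (x k - x l)))
    (hconf : IsConfident x θ P a r) (hrun : IsRatioRun x P a r w i j) {n : ℕ} {c : ℝ}
    (hn : (n : ℕ∞) ≤ stopTime x P a r i) (hc0 : 0 ≤ c)
    (hc : ∀ t < n, confRadius x P a t ^ 2 ≤ c) :
    (n : ℝ) ≤ K + complexity x θ w P.eps best * c := by
  have hH := fun k => armComplexity_nonneg (x := x) (θ := θ) (w := w) (best := best) P.eps k
  rcases le_total n K with h | h
  · have h1 : (n : ℝ) ≤ K := by exact_mod_cast h
    have := mul_nonneg (complexity_nonneg (x := x) (θ := θ) (w := w) (best := best) P.eps) hc0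
    linarith
  -- The bound holds just before arm k is pulled and the pull adds 1; the initial pull fits into the
  -- same +1. These ones add up to K.
  have key : ∀ k, (pullCount a n k : ℝ) ≤ armComplexity x θ w P.eps best k * c + 1 := by
    intro k
    induction n, h using Nat.le_induction with
    | base =>
      rw [pullCount_init hrun]
      have := mul_nonneg (hH k) hc0
      push_cast
      linarith
    | succ t ht ih =>
      have hlt : (t : ℕ∞) < stopTime x P a r i :=
        lt_of_lt_of_le (by exact_mod_cast Nat.lt_succ_self t) hn
      rw [pullCount_succ]
      split_ifs with hk
      · have h1 := pullCount_le_of_lt_stopTime heps hlam hbest hfin hw hconf hrun ht hlt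
        rw [hk] at h1
        have h2 := mul_le_mul_of_nonneg_left (hc t (Nat.lt_succ_self t)) (hH k)
        push_cast
        linarith
      · rw [add_zero]
        exact ih hlt.le fun s hs => hc s (hs.trans (Nat.lt_succ_self t))
  calc (n : ℝ) = ∑ k, (pullCount a n k : ℝ) := by exact_mod_cast (sum_pullCount a n).symm
    _ ≤ ∑ k, (armComplexity x θ w P.eps best k * c + 1) := Finset.sum_le_sum fun k _ => key k
    _ = _ := by
      rw [Finset.sum_add_distrib, ← Finset.sum_mul, complexity_eq_sum]
      simp [add_comm]

end Counting

/-! ### From a bound on the self-normalized noise to valid confidence intervals -/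

section Confidence

variable {d K : ℕ} (x : Fin K → EuclideanSpace ℝ (Fin d)) (θ : EuclideanSpace ℝ (Fin d))
  {P : Params} (a : ℕ → Fin K)

/-- The noise part of the response vector. -/
def noiseVec (e : ℕ → ℝ) (t : ℕ) : Fin d → ℝ := ∑ s ∈ Finset.range t, e s • (x (a s)).ofLp

/-- The logarithm in the confidence radius, without the factor `2`. -/
def logTerm (P : Params) (t : ℕ) : ℝ :=
  Real.log (P.kappa * (designMatrix x P a t).det ^ (1 / 2 : ℝ) *
      (P.lam • (1 : Matrix (Fin d) (Fin d) ℝ)).det ^ (-(1 / 2) : ℝ) / P.delta)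

lemma logTerm_eq (hlam : 0 < P.lam) (hkappa : 0 < P.kappa) (hdelta : 0 < P.delta) (t : ℕ) :
    logTerm x a P t = Real.log P.kappa - Real.log P.delta +
      (Real.log (designMatrix x P a t).det -
        Real.log (P.lam • (1 : Matrix (Fin d) (Fin d) ℝ)).det) / 2 := by
  have h1 := (designMatrix_posDef x a hlam t).det_pos
  have h2 := det_smul_one_pos (d := d) hlam
  rw [logTerm, Real.log_div (by positivity) hdelta.ne', Real.log_mul (by positivity) (by positivity),
    Real.log_mul (by positivity) (by positivity), Real.log_rpow h1, Real.log_rpow h2]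
  ring

/-- Applying A_t⁻¹ splits the estimation error into the noise and the bias -λθ caused by the
regularization. -/
lemma responseVec_eq (e : ℕ → ℝ) (t : ℕ) :
    (responseVec x a (fun s => inner ℝ (x (a s)) θ + e s) t).ofLp =
      designMatrix x P a t *ᵥ θ.ofLp - P.lam • θ.ofLp + noiseVec x a e t := by
  induction t with
  | zero => simp [responseVec, designMatrix, noiseVec, Matrix.smul_mulVec]
  | succ t ih =>
    have h : responseVec x a (fun s => inner ℝ (x (a s)) θ + e s) (t + 1) =
        responseVec x a (fun s => inner ℝ (x (a s)) θ + e s) t +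
          (inner ℝ (x (a t)) θ + e t) • x (a t) := by
      simp [responseVec, Finset.sum_range_succ]
    rw [h, WithLp.ofLp_add, ih, designMatrix_succ, Matrix.add_mulVec, Matrix.vecMulVec_mulVec,
      noiseVec, noiseVec, Finset.sum_range_succ, WithLp.ofLp_smul, dotProduct_ofLp, add_smul,
      op_smul_eq_smul]
    abel

lemma estimator_sub (hlam : 0 < P.lam) (e : ℕ → ℝ) (t : ℕ) :
    (estimator x P a (fun s => inner ℝ (x (a s)) θ + e s) t).ofLp - θ.ofLp =
      (designMatrix x P a t)⁻¹ *ᵥ (noiseVec x a e t - P.lam • θ.ofLp) := by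
  have hA := designMatrix_posDef x a hlam t
  rw [estimator]
  simp only
  rw [responseVec_eq x θ (P := P), Matrix.mulVec_add, Matrix.mulVec_sub, Matrix.mulVec_sub,
    inv_mulVec_mulVec hA]
  abel

/-- Equality holds at t = 0, and a rank-one update only lowers the inverse form. For q = θ this
yields the summand √λ S of the confidence radius. -/
lemma quadForm_inv_designMatrix_le (hlam : 0 < P.lam) (t : ℕ) (q : Fin d → ℝ) :
    (P.lam • q) ⬝ᵥ (designMatrix x P a t)⁻¹ *ᵥ (P.lam • q) ≤ P.lam * (q ⬝ᵥ q) := by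
  have hA := designMatrix_posDef x a hlam t
  induction t with
  | zero =>
    have h1 : designMatrix x P a 0 = P.lam • 1 := by simp [designMatrix]
    have h2 : designMatrix x P a 0 *ᵥ q = P.lam • q := by
      rw [h1, Matrix.smul_mulVec, Matrix.one_mulVec]
    rw [← h2, inv_mulVec_mulVec hA, h2, smul_dotProduct, smul_eq_mul]
  | succ t ih =>
    have hA' := designMatrix_posDef x a hlam t
    have h := quadForm_inv_add_vecMulVec_self hA' (x (a t)).ofLp (P.lam • q) 0
    have hu := dotProduct_inv_mulVec_nonneg hA' (x (a t)).ofLp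
    rw [← designMatrix_succ, zero_smul, add_zero] at h
    rw [h]
    have : ((x (a t)).ofLp ⬝ᵥ (designMatrix x P a t)⁻¹ *ᵥ (x (a t)).ofLp * 0 ^ 2 +
        2 * ((x (a t)).ofLp ⬝ᵥ (designMatrix x P a t)⁻¹ *ᵥ (P.lam • q)) * 0 -
        ((x (a t)).ofLp ⬝ᵥ (designMatrix x P a t)⁻¹ *ᵥ (P.lam • q)) ^ 2) /
        (1 + (x (a t)).ofLp ⬝ᵥ (designMatrix x P a t)⁻¹ *ᵥ (x (a t)).ofLp) ≤ 0 := by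
      apply div_nonpos_of_nonpos_of_nonneg _ (by linarith)
      nlinarith [sq_nonneg ((x (a t)).ofLp ⬝ᵥ (designMatrix x P a t)⁻¹ *ᵥ (P.lam • q))]
    linarith [ih hA']

/-- A bound for the self-normalized noise makes all confidence intervals valid. -/
lemma isConfident_of_noise_le (hlam : 0 < P.lam) (hθ : ‖θ‖ ≤ P.S) (e : ℕ → ℝ)
    (h : ∀ t, √(noiseVec x a e t ⬝ᵥ (designMatrix x P a t)⁻¹ *ᵥ noiseVec x a e t) ≤
      P.R * √(2 * logTerm x a P t)) :
    IsConfident x θ P a (fun s => inner ℝ (x (a s)) θ + e s) := by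
  intro t k l
  have hA := designMatrix_posDef x a hlam t
  have h1 : estGap x P a (fun s => inner ℝ (x (a s)) θ + e s) t k l - inner ℝ (x k - x l) θ =
      (x k - x l).ofLp ⬝ᵥ (designMatrix x P a t)⁻¹ *ᵥ (noiseVec x a e t - P.lam • θ.ofLp) := by
    rw [← estimator_sub x θ a hlam, dotProduct_sub, dotProduct_ofLp, dotProduct_ofLp, estGap]
  rw [h1, confWidth, matNorm, confRadius]
  refine (abs_dotProduct_inv_mulVec_sub_le hA _ _ _).trans
    (mul_le_mul_of_nonneg_left (add_le_add (h t) ?_) (Real.sqrt_nonneg _))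
  have h2 := quadForm_inv_designMatrix_le x a hlam t θ.ofLp
  rw [dotProduct_ofLp θ θ, real_inner_self_eq_norm_sq] at h2
  calc _ ≤ √(P.lam * ‖θ‖ ^ 2) := Real.sqrt_le_sqrt h2
    _ = √P.lam * ‖θ‖ := by rw [Real.sqrt_mul hlam.le, Real.sqrt_sq (norm_nonneg _)]
    _ ≤ _ := by
      rw [← Real.sqrt_eq_rpow]
      exact mul_le_mul_of_nonneg_left hθ (Real.sqrt_nonneg _)

end Confidence

/-! ### The order of the remainder -/

section Remainder

/-- The additive constant log K² is absorbed because log(1/δ) stays above l0. -/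
lemma log_sq_div_le {K : ℕ} (hK : 1 ≤ K) {l0 delta : ℝ} (hl0 : 0 < l0) (hdelta : 0 < delta)
    (h : l0 ≤ Real.log (1 / delta)) :
    Real.log ((K : ℝ) ^ 2 / delta) ≤ (1 + Real.log ((K : ℝ) ^ 2) / l0) * Real.log (1 / delta) := by
  have hK' : (1 : ℝ) ≤ K := by exact_mod_cast hK
  have hK2 : 0 ≤ Real.log ((K : ℝ) ^ 2) := Real.log_nonneg (one_le_pow₀ hK')
  have h1 : Real.log ((K : ℝ) ^ 2 / delta) = Real.log ((K : ℝ) ^ 2) + Real.log (1 / delta) := by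
    rw [← Real.log_mul (by positivity) (by positivity), mul_one_div]
  have h2 : Real.log ((K : ℝ) ^ 2) ≤ Real.log ((K : ℝ) ^ 2) / l0 * Real.log (1 / delta) := by
    rw [div_mul_eq_mul_div, le_div_iff₀ hl0]
    exact mul_le_mul_of_nonneg_left h hK2
  rw [h1]
  linarith

/-- The additive constant log(1 + c) is absorbed because log X ≥ log η > 0. -/
lemma log_one_add_mul_sq_le {c z X eta : ℝ} (hc : 0 ≤ c) (hz : 0 ≤ z) (heta : 1 < eta)
    (hX : eta ≤ X) (h : z ≤ c * X ^ 2) :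
    Real.log (1 + z) ≤ (Real.log (1 + c) / Real.log eta + 2) * Real.log X := by
  have hX1 : 1 < X := heta.trans_le hX
  have hle : Real.log eta ≤ Real.log X := Real.log_le_log (by linarith) hX
  have h1 : Real.log (1 + z) ≤ Real.log ((1 + c) * X ^ 2) := by
    apply Real.log_le_log (by linarith)
    nlinarith
  rw [Real.log_mul (by linarith) (by positivity), Real.log_pow] at h1
  have h2 : Real.log (1 + c) ≤ Real.log (1 + c) / Real.log eta * Real.log X := by
    rw [div_mul_eq_mul_div, le_div_iff₀ (Real.log_pos heta)]
    exact mul_le_mul_of_nonneg_left hle (Real.log_nonneg (by linarith))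
  push_cast at h1
  linarith

/-- The remainder is of the order `d H log (d H log (1 / δ))`. -/
lemma remainder_le {K : ℕ} (hK : 1 ≤ K) (R L : ℝ) {h₀ δ₀ lam₀ η : ℝ}
    (hh₀ : 0 < h₀) (hδ₀ : δ₀ < 1) (hlam₀ : 0 < lam₀) (hη : 1 < η) :
    ∃ c : ℝ, ∀ (d' : ℕ) (H' δ' lam' : ℝ), 1 ≤ d' → h₀ ≤ H' → 0 < δ' → δ' ≤ δ₀ →
        lam₀ ≤ lam' → η ≤ d' * H' * Real.log (1 / δ') →
          remainder K d' R L lam' H' δ' ≤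
            c * (d' * H' * Real.log (d' * H' * Real.log (1 / δ'))) := by
  rcases le_or_gt δ₀ 0 with hneg | hδpos
  · exact ⟨0, fun _ _ _ _ _ _ h1 h2 _ _ => absurd h1 (not_lt.2 (h2.trans hneg))⟩
  set l0 := Real.log (1 / δ₀) with hl0def
  have hl0 : 0 < l0 := Real.log_pos (by rw [lt_div_iff₀ hδpos]; linarith)
  -- With X = dH log(1/δ), these constants are made for N ≤ c1 X and M²L²/(λd) ≤ c2 X².
  set c1 := 8 * R ^ 2 * (1 + Real.log ((K : ℝ) ^ 2) / l0) + K with hc1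
  set c2 := 4 * (16 * R ^ 4 * L ^ 2 / (l0 ^ 2 * lam₀) + c1 ^ 2) * L ^ 2 / lam₀ with hc2
  have hK' : (1 : ℝ) ≤ K := by exact_mod_cast hK
  have hK2 : 0 ≤ Real.log ((K : ℝ) ^ 2) := Real.log_nonneg (one_le_pow₀ hK')
  have hc10 : 0 ≤ c1 := by positivity
  have hc20 : 0 ≤ c2 := by positivity
  -- The first summand pays for the K in the remainder, using dH ≥ h₀ and log X ≥ log η.
  refine ⟨K / (h₀ * Real.log η) + 4 * R ^ 2 * (Real.log (1 + c2) / Real.log η + 2), ?_⟩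
  intro d H δ lam hd hH hδ hδle hlam hX
  set l := Real.log (1 / δ) with hl
  set X := d * H * l with hXdef
  have hd' : (1 : ℝ) ≤ d := by exact_mod_cast hd
  have hH0 : 0 < H := hh₀.trans_le hH
  have hlam0 : 0 < lam := hlam₀.trans_le hlam
  have hll0 : l0 ≤ l := Real.log_le_log (by positivity) (one_div_le_one_div_of_le hδ hδle)
  have hl0' : 0 < l := hl0.trans_le hll0
  have hX1 : 1 < X := hη.trans_le hX
  have hlogη : 0 < Real.log η := Real.log_pos hη
  have hlogX : Real.log η ≤ Real.log X := Real.log_le_log (by linarith) hX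
  have hdH : h₀ ≤ d * H := by nlinarith
  have hHl : H * l ≤ X := by
    rw [hXdef, mul_assoc]
    exact le_mul_of_one_le_left (by positivity) hd'
  have hN0 : 0 ≤ auxN K R H δ := by
    have : 0 ≤ Real.log ((K : ℝ) ^ 2 / δ) := by
      apply Real.log_nonneg
      rw [le_div_iff₀ hδ]
      nlinarith
    unfold auxN
    positivity
  have hN : auxN K R H δ ≤ c1 * X := by
    have h1 := log_sq_div_le hK hl0 hδ hll0
    calc auxN K R H δ
        ≤ 8 * H * R ^ 2 * ((1 + Real.log ((K : ℝ) ^ 2) / l0) * l) + K * X := by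
          unfold auxN
          gcongr
          nlinarith
      _ = 8 * R ^ 2 * (1 + Real.log ((K : ℝ) ^ 2) / l0) * (H * l) + K * X := by ring
      _ ≤ 8 * R ^ 2 * (1 + Real.log ((K : ℝ) ^ 2) / l0) * X + K * X := by gcongr
      _ = c1 * X := by rw [hc1]; ring
  have hHd : H ^ 2 * d ≤ X ^ 2 / l0 ^ 2 := by
    rw [le_div_iff₀ (by positivity), hXdef]
    calc H ^ 2 * d * l0 ^ 2 ≤ H ^ 2 * (d * d) * l ^ 2 := by
          gcongr
          exact le_mul_of_one_le_left (by linarith) hd'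
      _ = _ := by ring
  have hM : auxM K d R L lam H δ ^ 2 ≤
      4 * (16 * R ^ 4 * L ^ 2 / (l0 ^ 2 * lam₀) + c1 ^ 2) * X ^ 2 := by
    rw [auxM, mul_pow, Real.sq_sqrt (by positivity)]
    calc 2 ^ 2 * (16 * H ^ 2 * R ^ 4 * d * L ^ 2 / lam + auxN K R H δ ^ 2)
        = 2 ^ 2 * (16 * R ^ 4 * L ^ 2 * (H ^ 2 * d) / lam + auxN K R H δ ^ 2) := by ring
      _ ≤ 2 ^ 2 * (16 * R ^ 4 * L ^ 2 * (X ^ 2 / l0 ^ 2) / lam₀ + (c1 * X) ^ 2) := by gcongr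
      _ = _ := by field_simp; ring
  have hz : auxM K d R L lam H δ ^ 2 * L ^ 2 / (lam * d) ≤ c2 * X ^ 2 := by
    calc auxM K d R L lam H δ ^ 2 * L ^ 2 / (lam * d)
        ≤ (4 * (16 * R ^ 4 * L ^ 2 / (l0 ^ 2 * lam₀) + c1 ^ 2) * X ^ 2) * L ^ 2 / lam₀ := by
          gcongr
          exact hlam.trans (le_mul_of_one_le_right hlam0.le hd')
      _ = c2 * X ^ 2 := by rw [hc2]; ring
  have hlog := log_one_add_mul_sq_le hc20 (by positivity) hη hX hz
  have hKle : (K : ℝ) ≤ K / (h₀ * Real.log η) * (d * H * Real.log X) := by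
    rw [div_mul_eq_mul_div, le_div_iff₀ (by positivity)]
    gcongr
  calc remainder K d R L lam H δ
      = K + 4 * H * R ^ 2 * d * Real.log (1 + auxM K d R L lam H δ ^ 2 * L ^ 2 / (lam * d)) := rfl
    _ ≤ K / (h₀ * Real.log η) * (d * H * Real.log X) +
        4 * H * R ^ 2 * d * ((Real.log (1 + c2) / Real.log η + 2) * Real.log X) := by gcongr
    _ = _ := by ring

end Remainder

/-! ### Solving the implicit inequality for the stopping time -/

section StoppingBounds

/-- Solving the inequality `n ≤ N + 4 H R² d log (1 + n L² / (λ d))` for `n`. -/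
lemma le_auxM_sq {K d n : ℕ} (hK : 1 ≤ K) {R L lam H delta : ℝ} (hlam : 0 < lam) (hH : 0 ≤ H)
    (hlog : 0 ≤ Real.log ((K : ℝ) ^ 2 / delta))
    (h : (n : ℝ) ≤ auxN K R H delta + 4 * H * R ^ 2 * d * Real.log (1 + n * L ^ 2 / (lam * d))) :
    (n : ℝ) ≤ auxM K d R L lam H delta ^ 2 := by
  have hK' : (1 : ℝ) ≤ K := by exact_mod_cast hK
  have hN : 1 ≤ auxN K R H delta := by
    have : 0 ≤ 8 * H * R ^ 2 * Real.log ((K : ℝ) ^ 2 / delta) := by positivity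
    unfold auxN
    linarith
  set q := 16 * H ^ 2 * R ^ 4 * d * L ^ 2 / lam with hq
  have hq0 : 0 ≤ q := by positivity
  rw [auxM, mul_pow, ← hq, Real.sq_sqrt (by positivity)]
  set z := n * L ^ 2 / (lam * d) with hz
  have hz0 : 0 ≤ z := by positivity
  have hlogz : Real.log (1 + z) ≤ 2 * √z := by
    have h1 : Real.log (1 + z) ≤ Real.log ((1 + √z) ^ 2) := by
      apply Real.log_le_log (by linarith)
      nlinarith [Real.sq_sqrt hz0, Real.sqrt_nonneg z]
    have h2 := Real.log_le_sub_one_of_pos (by positivity : 0 < 1 + √z)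
    rw [Real.log_pow] at h1
    push_cast at h1
    linarith
  -- The left side is at most 2√(qn) (with equality if d > 0), so AM–GM for 2q and n/2 applies.
  have hs : 4 * H * R ^ 2 * d * (2 * √z) ≤ 2 * q + n / 2 := by
    have h1 : (4 * H * R ^ 2 * d * (2 * √z)) ^ 2 ≤ 4 * (q * n) := by
      rw [mul_pow, mul_pow 2, Real.sq_sqrt hz0, hz, hq]
      rcases Nat.eq_zero_or_pos d with rfl | hd
      · simp
      · apply le_of_eq
        field_simp
        ring
    apply (abs_le_of_sq_le_sq' _ (by positivity)).2
    nlinarith [sq_nonneg (2 * q - n / 2)]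
  have : 4 * H * R ^ 2 * d * Real.log (1 + z) ≤ 4 * H * R ^ 2 * d * (2 * √z) := by gcongr
  -- Moving n/2 to the left gives n ≤ 2N + 4q, and 2N ≤ 4N² since N ≥ 1.
  nlinarith

/-- Bounding all naturals below T instead of T itself also gives finiteness: T = ⊤ would bound every
natural number. -/
lemma exists_eq_natCast_of_forall_le {T : ℕ∞} {b : ℝ} (h : ∀ n : ℕ, (n : ℕ∞) ≤ T → (n : ℝ) ≤ b) :
    ∃ n : ℕ, T = n ∧ (n : ℝ) ≤ b := by
  induction T with
  | top =>
    obtain ⟨n, hn⟩ := exists_nat_gt b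
    exact absurd (h n le_top) (not_le.2 hn)
  | coe n => exact ⟨n, rfl, h n le_rfl⟩

variable {d K : ℕ} {x : Fin K → EuclideanSpace ℝ (Fin d)} {θ : EuclideanSpace ℝ (Fin d)}
  {P : Params} {a : ℕ → Fin K} {r : ℕ → ℝ} {best : Fin K}
  {w : EuclideanSpace ℝ (Fin d) → Fin K → ℝ} {i j : ℕ → Fin K}

/-- The logarithm in the confidence radius is bounded via the determinant–trace inequality. -/
lemma confRadius_le (hlam : 0 < P.lam) (hdelta : 0 < P.delta) (hR : 0 ≤ P.R) (hK : 1 ≤ K)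
    (hkappa : P.kappa = 1 ∨ P.kappa = (K : ℝ) ^ 2) {t n : ℕ} (htn : t ≤ n) :
    confRadius x P a t ≤ P.R * √(2 * Real.log ((K : ℝ) ^ 2 / P.delta) +
      d * Real.log (1 + n * maxNorm x ^ 2 / (P.lam * d))) + √P.lam * P.S := by
  have hK' : (1 : ℝ) ≤ K := by exact_mod_cast hK
  have hk0 : 0 < P.kappa := by rcases hkappa with h | h <;> rw [h] <;> positivity
  have hk : Real.log P.kappa ≤ Real.log ((K : ℝ) ^ 2) := by
    apply Real.log_le_log hk0
    rcases hkappa with h | h <;> rw [h]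
    exact one_le_pow₀ hK'
  have h1 := log_det_designMatrix_sub_le x a hlam t
  have h2 : Real.log (1 + t * maxNorm x ^ 2 / (P.lam * d)) ≤
      Real.log (1 + n * maxNorm x ^ 2 / (P.lam * d)) := by
    have : (t : ℝ) ≤ n := by exact_mod_cast htn
    gcongr
  have h3 := mul_le_mul_of_nonneg_left h2 (Nat.cast_nonneg (α := ℝ) d)
  rw [confRadius, Real.sqrt_eq_rpow P.lam]
  apply add_le_add_left
  apply mul_le_mul_of_nonneg_left _ hR
  apply Real.sqrt_le_sqrt
  have h4 := logTerm_eq x a hlam hk0 hdelta t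
  rw [logTerm] at h4
  rw [h4, Real.log_div (by positivity) hdelta.ne']
  linarith

lemma confRadius_nonneg (hR : 0 ≤ P.R) (hS : 0 < P.S) (hlam : 0 < P.lam) (t : ℕ) :
    0 ≤ confRadius x P a t := by
  unfold confRadius
  positivity

lemma log_sq_div_nonneg (hK : 1 ≤ K) {delta : ℝ} (hdelta : 0 < delta) (hdelta1 : delta < 1) :
    0 ≤ Real.log ((K : ℝ) ^ 2 / delta) := by
  have hK' : (1 : ℝ) ≤ K := by exact_mod_cast hK
  apply Real.log_nonneg
  rw [le_div_iff₀ hdelta]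
  nlinarith

/-- The bound on the stopping time for small regularization. -/
lemma stopTime_le_of_small_regularization (heps : 0 ≤ P.eps) (hdelta : 0 < P.delta)
    (hdelta1 : P.delta < 1) (hlam : 0 < P.lam) (hR : 0 ≤ P.R) (hS : 0 < P.S)
    (hkappa : P.kappa = 1 ∨ P.kappa = (K : ℝ) ^ 2)
    (hbest : ∀ k, inner ℝ (x k) θ ≤ inner ℝ (x best) θ)
    (hfin : 0 < P.eps ∨ ∀ k, k ≠ best → inner ℝ (x k) θ < inner ℝ (x best) θ)
    (hw : ∀ k l, IsL1Solution x (x k - x l) (w (x k - x l)))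
    (hconf : IsConfident x θ P a r) (hrun : IsRatioRun x P a r w i j)
    (hsmall : P.lam ≤ 2 * P.R ^ 2 / P.S ^ 2 * Real.log ((K : ℝ) ^ 2 / P.delta)) :
    ∃ n : ℕ, stopTime x P a r i = n ∧
      (n : ℝ) ≤ 8 * complexity x θ w P.eps best * P.R ^ 2 * Real.log ((K : ℝ) ^ 2 / P.delta) +
        remainder K d P.R (maxNorm x) P.lam (complexity x θ w P.eps best) P.delta := by
  have hK : 1 ≤ K := Nat.one_le_iff_ne_zero.2 fun h => (h ▸ best).elim0
  have hlog := log_sq_div_nonneg hK hdelta hdelta1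
  have hH := complexity_nonneg (x := x) (θ := θ) (w := w) (best := best) P.eps
  set H := complexity x θ w P.eps best
  -- Small λ means that the bias is at most the noise part, so C_t at most doubles; this is the
  -- source of 4R².
  have hlamS : √P.lam * P.S ≤ P.R * √(2 * Real.log ((K : ℝ) ^ 2 / P.delta)) := by
    rw [← Real.sqrt_sq hS.le, ← Real.sqrt_sq hR, ← Real.sqrt_mul hlam.le,
      ← Real.sqrt_mul (sq_nonneg _)]
    apply Real.sqrt_le_sqrt
    rw [div_mul_eq_mul_div, le_div_iff₀ (by positivity)] at hsmall
    linarith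
  apply exists_eq_natCast_of_forall_le
  intro n hn
  set D := d * Real.log (1 + n * maxNorm x ^ 2 / (P.lam * d)) with hD
  have hD0 : 0 ≤ D := mul_nonneg (Nat.cast_nonneg d)
    (Real.log_nonneg (le_add_of_nonneg_right (by positivity)))
  have hmain : (n : ℝ) ≤ K + H * (4 * P.R ^ 2 * (2 * Real.log ((K : ℝ) ^ 2 / P.delta) + D)) := by
    apply natCast_le_of_le_stopTime heps hlam hbest hfin hw hconf hrun hn (by positivity)
    intro t ht
    have h1 := confRadius_le (x := x) (a := a) hlam hdelta hR hK hkappa ht.le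
    have h2 : P.R * √(2 * Real.log ((K : ℝ) ^ 2 / P.delta)) ≤
        P.R * √(2 * Real.log ((K : ℝ) ^ 2 / P.delta) + D) :=
      mul_le_mul_of_nonneg_left (Real.sqrt_le_sqrt (by linarith)) hR
    calc confRadius x P a t ^ 2
        ≤ (2 * (P.R * √(2 * Real.log ((K : ℝ) ^ 2 / P.delta) + D))) ^ 2 :=
          pow_le_pow_left₀ (confRadius_nonneg hR hS hlam t) (by linarith) 2
      _ = _ := by rw [mul_pow, mul_pow, Real.sq_sqrt (by positivity)]; ring
  have hmain' : (n : ℝ) ≤ auxN K P.R H P.delta +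
      4 * H * P.R ^ 2 * d * Real.log (1 + n * maxNorm x ^ 2 / (P.lam * d)) := by
    rw [auxN]
    linarith
  -- A crude bound on n suffices, as it only enters inside the logarithm.
  have hnM := le_auxM_sq hK hlam hH hlog hmain'
  refine hmain'.trans ?_
  rw [auxN, remainder, add_assoc]
  gcongr

/-- The bound on the stopping time for large regularization. -/
lemma stopTime_le_of_large_regularization (heps : 0 ≤ P.eps) (hdelta : 0 < P.delta)
    (hdelta1 : P.delta < 1) (hlam : 0 < P.lam) (hR : 0 ≤ P.R) (hS : 0 < P.S)
    (hkappa : P.kappa = 1 ∨ P.kappa = (K : ℝ) ^ 2)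
    (hbest : ∀ k, inner ℝ (x k) θ ≤ inner ℝ (x best) θ)
    (hfin : 0 < P.eps ∨ ∀ k, k ≠ best → inner ℝ (x k) θ < inner ℝ (x best) θ)
    (hw : ∀ k l, IsL1Solution x (x k - x l) (w (x k - x l)))
    (hconf : IsConfident x θ P a r) (hrun : IsRatioRun x P a r w i j)
    (hlarge : 4 * complexity x θ w P.eps best * P.R ^ 2 * maxNorm x ^ 2 < P.lam) :
    ∃ n : ℕ, stopTime x P a r i = n ∧
      (n : ℝ) ≤ 8 * complexity x θ w P.eps best * P.R ^ 2 * Real.log ((K : ℝ) ^ 2 / P.delta) +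
        4 * complexity x θ w P.eps best * P.lam * P.S ^ 2 + 2 * K := by
  have hK : 1 ≤ K := Nat.one_le_iff_ne_zero.2 fun h => (h ▸ best).elim0
  have hlog := log_sq_div_nonneg hK hdelta hdelta1
  have hH := complexity_nonneg (x := x) (θ := θ) (w := w) (best := best) P.eps
  set H := complexity x θ w P.eps best
  apply exists_eq_natCast_of_forall_le
  intro n hn
  set D := d * Real.log (1 + n * maxNorm x ^ 2 / (P.lam * d)) with hD
  have hD0 : 0 ≤ D := mul_nonneg (Nat.cast_nonneg d)
    (Real.log_nonneg (le_add_of_nonneg_right (by positivity)))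
  have hDle : D ≤ n * maxNorm x ^ 2 / P.lam := by
    rcases Nat.eq_zero_or_pos d with h | h
    · have h' : (d : ℝ) = 0 := by exact_mod_cast h
      rw [hD, h', zero_mul]
      positivity
    · have hz : 0 ≤ n * maxNorm x ^ 2 / (P.lam * d) := by positivity
      have h1 := Real.log_le_sub_one_of_pos (by linarith : 0 < 1 + n * maxNorm x ^ 2 / (P.lam * d))
      have h2 := mul_le_mul_of_nonneg_left h1 (Nat.cast_nonneg (α := ℝ) d)
      refine h2.trans (le_of_eq ?_)
      field_simp
      ring
  have hmain : (n : ℝ) ≤ K + H * (2 * P.R ^ 2 * (2 * Real.log ((K : ℝ) ^ 2 / P.delta) + D) +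
      2 * P.lam * P.S ^ 2) := by
    apply natCast_le_of_le_stopTime heps hlam hbest hfin hw hconf hrun hn (by positivity)
    intro t ht
    have h1 := confRadius_le (x := x) (a := a) hlam hdelta hR hK hkappa ht.le
    set u := P.R * √(2 * Real.log ((K : ℝ) ^ 2 / P.delta) + D) with hu
    set v := √P.lam * P.S with hv
    have hu2 : u ^ 2 = P.R ^ 2 * (2 * Real.log ((K : ℝ) ^ 2 / P.delta) + D) := by
      rw [hu, mul_pow, Real.sq_sqrt (by positivity)]
    have hv2 : v ^ 2 = P.lam * P.S ^ 2 := by rw [hv, mul_pow, Real.sq_sqrt hlam.le]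
    calc confRadius x P a t ^ 2 ≤ (u + v) ^ 2 :=
          pow_le_pow_left₀ (confRadius_nonneg hR hS hlam t) h1 2
      _ ≤ 2 * u ^ 2 + 2 * v ^ 2 := by nlinarith [sq_nonneg (u - v)]
      _ = _ := by rw [hu2, hv2]; ring
  -- This is where λ > 4HR²L² enters. Absorbing n/2 on the left doubles all other terms, hence 2K.
  have hhalf : H * (2 * P.R ^ 2 * D) ≤ n / 2 := by
    calc H * (2 * P.R ^ 2 * D) ≤ H * (2 * P.R ^ 2 * (n * maxNorm x ^ 2 / P.lam)) := by gcongr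
      _ = n / 2 * ((4 * H * P.R ^ 2 * maxNorm x ^ 2) / P.lam) := by field_simp; ring
      _ ≤ n / 2 * 1 := by
        gcongr
        exact (div_le_one hlam).2 hlarge.le
      _ = n / 2 := mul_one _
  linarith

end StoppingBounds

/-! ### Gaussian mixtures of exponentials -/

section Mixture

open ProbabilityTheory

/-- The value of the exponential `exp (g * e - g ^ 2 / 2)` averaged over a Gaussian `g` with mean
`v` and variance `u`. -/
def mixtureFactor (u v e : ℝ) : ℝ :=
  (√(1 + u))⁻¹ * Real.exp ((u * e ^ 2 + 2 * v * e - v ^ 2) / (2 * (1 + u)))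

lemma mixtureFactor_nonneg (u v e : ℝ) : 0 ≤ mixtureFactor u v e := by
  unfold mixtureFactor; positivity

/-- Completing the square in g. Zero variance is excluded because the density is then identically 0.
-/
lemma gaussianPDFReal_mul_exp {u : NNReal} (hu : u ≠ 0) (v e g : ℝ) :
    gaussianPDFReal v u g * Real.exp (g * e - g ^ 2 / 2) =
      mixtureFactor u v e * gaussianPDFReal ((v + u * e) / (1 + u)) (u / (1 + u)) g := by
  have hu' : (0 : ℝ) < u := by exact_mod_cast pos_iff_ne_zero.2 hu
  simp only [gaussianPDFReal_def, mixtureFactor]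
  push_cast
  have h1 : √(2 * Real.pi * u) = √(1 + u) * √(2 * Real.pi * (u / (1 + u))) := by
    rw [← Real.sqrt_mul (by positivity)]
    congr 1
    field_simp
  rw [h1, mul_inv, mul_assoc, ← Real.exp_add, mul_mul_mul_comm, ← Real.exp_add]
  congr 2
  field_simp
  ring

lemma lintegral_gaussianPDF_mul_exp {u : NNReal} (hu : u ≠ 0) (v e : ℝ) :
    ∫⁻ g, gaussianPDF v u g * ENNReal.ofReal (Real.exp (g * e - g ^ 2 / 2)) =
      ENNReal.ofReal (mixtureFactor u v e) := by
  have h : ∀ g, gaussianPDF v u g * ENNReal.ofReal (Real.exp (g * e - g ^ 2 / 2)) =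
      ENNReal.ofReal (mixtureFactor u v e) *
        gaussianPDF ((v + u * e) / (1 + u)) (u / (1 + u)) g := by
    intro g
    rw [gaussianPDF, gaussianPDF, ← ENNReal.ofReal_mul (gaussianPDFReal_nonneg _ _ _),
      gaussianPDFReal_mul_exp hu, ENNReal.ofReal_mul (mixtureFactor_nonneg _ _ _)]
  simp_rw [h]
  rw [lintegral_const_mul _ (measurable_gaussianPDF _ _), lintegral_gaussianPDF_eq_one, mul_one]
  exact div_ne_zero hu (by positivity)

end Mixture

/-! ### Conditional sub-Gaussian bounds and Ville's inequality -/

section Conditional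

open ProbabilityTheory

variable {Ω : Type*} {m mΩ : MeasurableSpace Ω} {μ : Measure Ω}

/-- A bound for the conditional expectation, tested against nonnegative functions. -/
lemma lintegral_mul_ofReal_le_of_condExp_le [IsProbabilityMeasure μ] (hm : m ≤ mΩ) {f : Ω → ℝ}
    (hf : Integrable f μ) (hf0 : ∀ ω, 0 ≤ f ω) {c : ℝ} (hc0 : 0 ≤ c)
    (hc : μ[f | m] ≤ᵐ[μ] fun _ => c) {Y : Ω → ENNReal}
    (hY : Measurable[m] Y) :
    ∫⁻ ω, Y ω * ENNReal.ofReal (f ω) ∂μ ≤ ENNReal.ofReal c * ∫⁻ ω, Y ω ∂μ := by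
  -- The conditional bound is a comparison of two measures on m, which passes to every nonnegative Y
  -- without integrability.
  have hle : (μ.withDensity fun ω => ENNReal.ofReal (f ω)).trim hm ≤
      (ENNReal.ofReal c • μ).trim hm := by
    refine Measure.le_iff.2 fun s hs => ?_
    rw [trim_measurableSet_eq hm hs, trim_measurableSet_eq hm hs, withDensity_apply _ (hm s hs),
      ← ofReal_integral_eq_lintegral_ofReal hf.integrableOn (ae_of_all _ hf0),
      ← setIntegral_condExp hm hf hs, Measure.smul_apply, smul_eq_mul, ← ofReal_measureReal,
      ← ENNReal.ofReal_mul hc0]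
    apply ENNReal.ofReal_le_ofReal
    calc ∫ ω in s, (μ[f | m]) ω ∂μ ≤ ∫ _ in s, c ∂μ :=
          setIntegral_mono_ae integrable_condExp.integrableOn (integrable_const c).integrableOn hc
      _ = c * μ.real s := by simp [mul_comm]
  calc ∫⁻ ω, Y ω * ENNReal.ofReal (f ω) ∂μ
      = ∫⁻ ω, Y ω ∂(μ.withDensity fun ω => ENNReal.ofReal (f ω)) := by
        rw [lintegral_withDensity_eq_lintegral_mul₀ hf.aemeasurable.ennreal_ofReal
          (hY.mono hm le_rfl).aemeasurable]
        simp [mul_comm]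
    _ = ∫⁻ ω, Y ω ∂(μ.withDensity fun ω => ENNReal.ofReal (f ω)).trim hm :=
        (lintegral_trim hm hY).symm
    _ ≤ ∫⁻ ω, Y ω ∂(ENNReal.ofReal c • μ).trim hm := lintegral_mono' hle le_rfl
    _ = ENNReal.ofReal c * ∫⁻ ω, Y ω ∂μ := by
        rw [lintegral_trim hm hY, lintegral_smul_measure, smul_eq_mul]

/-- Multiplying by a mixture factor of conditionally `1`-sub-Gaussian noise does not increase
expectations. -/
lemma lintegral_mul_mixtureFactor_le [IsProbabilityMeasure μ] (hm : m ≤ mΩ) {e : Ω → ℝ}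
    (he : Measurable e)
    (hint : ∀ s : ℝ, Integrable (fun ω => Real.exp (s * e ω)) μ)
    (hc : ∀ s : ℝ, μ[fun ω => Real.exp (s * e ω) | m] ≤ᵐ[μ] fun _ => Real.exp (s ^ 2 / 2))
    {u v : Ω → ℝ} (hu : Measurable[m] u) (hv : Measurable[m] v) (hu0 : ∀ ω, 0 ≤ u ω)
    (huv : ∀ ω, u ω = 0 → v ω = 0) {Z : Ω → ENNReal} (hZ : Measurable[m] Z) :
    ∫⁻ ω, Z ω * ENNReal.ofReal (mixtureFactor (u ω) (v ω) (e ω)) ∂μ ≤ ∫⁻ ω, Z ω ∂μ := by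
  have hA : MeasurableSet[m] {ω | u ω = 0} := hu (measurableSet_singleton 0)
  have hA' : MeasurableSet {ω | u ω = 0} := hm _ hA
  -- Where u = 0 there is no Gaussian density, but v = 0 there as well and the factor is exactly 1.
  set Y : Ω → ENNReal := ({ω | u ω = 0}ᶜ).indicator Z with hYdef
  have hY : Measurable[m] Y := hZ.indicator hA.compl
  have hpdf : ∀ g, Measurable[m] fun ω => Y ω * gaussianPDF (v ω) (u ω).toNNReal g := fun g =>
    hY.mul (measurable_uncurry_gaussianPDF.comp
      (hv.prodMk ((measurable_real_toNNReal.comp hu).prodMk measurable_const)))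
  have hu' := hu.mono hm le_rfl
  have hv' := hv.mono hm le_rfl
  have hY' := hY.mono hm le_rfl
  have hpdf2 : Measurable fun q : Ω × ℝ =>
      Y q.1 * gaussianPDF (v q.1) (u q.1).toNNReal q.2 :=
    (hY'.comp measurable_fst).mul (measurable_uncurry_gaussianPDF.comp
      ((hv'.comp measurable_fst).prodMk
        ((measurable_real_toNNReal.comp (hu'.comp measurable_fst)).prodMk measurable_snd)))
  have hexp2 : Measurable fun q : Ω × ℝ =>
      ENNReal.ofReal (Real.exp (q.2 * e q.1 - q.2 ^ 2 / 2)) := by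
    have he' : Measurable fun q : Ω × ℝ => e q.1 := he.comp measurable_fst
    fun_prop
  have hpos : ∀ ω, Y ω ≠ 0 → (u ω).toNNReal ≠ 0 := by
    intro ω h h0
    apply h
    rw [hYdef, Set.indicator_of_notMem]
    simpa using le_antisymm (Real.toNNReal_eq_zero.1 h0) (hu0 ω)
  -- Write the factor as an integral over g and swap. For fixed g the density is m-measurable, and
  -- the conditional bound exp(g²/2) cancels exp(-g²/2). Swapping back, the density integrates to 1.
  have hmain : ∫⁻ ω, Y ω * ENNReal.ofReal (mixtureFactor (u ω) (v ω) (e ω)) ∂μ ≤ ∫⁻ ω, Y ω ∂μ := by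
    calc ∫⁻ ω, Y ω * ENNReal.ofReal (mixtureFactor (u ω) (v ω) (e ω)) ∂μ
        = ∫⁻ ω, (∫⁻ g : ℝ, Y ω * gaussianPDF (v ω) (u ω).toNNReal g *
            ENNReal.ofReal (Real.exp (g * e ω - g ^ 2 / 2))) ∂μ := by
          refine lintegral_congr fun ω => ?_
          rcases eq_or_ne (Y ω) 0 with h | h
          · simp [h]
          simp_rw [mul_assoc]
          rw [lintegral_const_mul _ (by fun_prop),
            lintegral_gaussianPDF_mul_exp (hpos ω h), Real.coe_toNNReal _ (hu0 ω)]
      _ = ∫⁻ g : ℝ, ∫⁻ ω, Y ω * gaussianPDF (v ω) (u ω).toNNReal g *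
            ENNReal.ofReal (Real.exp (g * e ω - g ^ 2 / 2)) ∂μ :=
          lintegral_lintegral_swap (hpdf2.mul hexp2).aemeasurable
      _ ≤ ∫⁻ g : ℝ, ∫⁻ ω, Y ω * gaussianPDF (v ω) (u ω).toNNReal g ∂μ := by
          refine lintegral_mono fun g => ?_
          have h1 := lintegral_mul_ofReal_le_of_condExp_le hm (hint g)
            (fun ω => (Real.exp_pos _).le) (Real.exp_pos _).le (hc g) (hpdf g)
          have h2 : ∀ ω, Y ω * gaussianPDF (v ω) (u ω).toNNReal g *
              ENNReal.ofReal (Real.exp (g * e ω - g ^ 2 / 2)) =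
              ENNReal.ofReal (Real.exp (-(g ^ 2 / 2))) * (Y ω * gaussianPDF (v ω) (u ω).toNNReal g *
              ENNReal.ofReal (Real.exp (g * e ω))) := by
            intro ω
            rw [sub_eq_add_neg, Real.exp_add, ENNReal.ofReal_mul (Real.exp_pos _).le]
            ring
          simp_rw [h2]
          rw [lintegral_const_mul' _ _ ENNReal.ofReal_ne_top]
          refine (mul_le_mul_right h1 _).trans (le_of_eq ?_)
          rw [← mul_assoc, ← ENNReal.ofReal_mul (Real.exp_pos _).le, ← Real.exp_add]
          simp
      _ = ∫⁻ ω, (∫⁻ g : ℝ, Y ω * gaussianPDF (v ω) (u ω).toNNReal g) ∂μ :=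
          (lintegral_lintegral_swap hpdf2.aemeasurable).symm
      _ = ∫⁻ ω, Y ω ∂μ := by
          refine lintegral_congr fun ω => ?_
          rcases eq_or_ne (Y ω) 0 with h | h
          · simp [h]
          rw [lintegral_const_mul _ (measurable_gaussianPDF _ _),
            lintegral_gaussianPDF_eq_one _ (hpos ω h), mul_one]
  rw [← lintegral_add_compl _ hA', ← lintegral_add_compl Z hA']
  refine add_le_add (le_of_eq ?_) ?_
  · refine setLIntegral_congr_fun hA' fun ω hω => ?_
    have hω' : u ω = 0 := hω
    simp [mixtureFactor, hω', huv ω hω']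
  · rw [← lintegral_indicator hA'.compl, ← lintegral_indicator hA'.compl]
    refine le_trans (le_of_eq (lintegral_congr fun ω => ?_)) hmain
    by_cases h : ω ∈ {ω | u ω = 0}ᶜ <;> simp [hYdef, Set.indicator, h]

/-- Ville's maximal inequality for nonnegative supermartingales. -/
lemma mul_measure_exists_le_of_supermartingale (ℱ : Filtration ℕ mΩ) {M : ℕ → Ω → ENNReal}
    (hM : ∀ t, Measurable[ℱ t] (M t)) (h0 : ∫⁻ ω, M 0 ω ∂μ ≤ 1)
    (hstep : ∀ t s, MeasurableSet[ℱ t] s → ∫⁻ ω in s, M (t + 1) ω ∂μ ≤ ∫⁻ ω in s, M t ω ∂μ)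
    (c : ENNReal) : c * μ {ω | ∃ t, c ≤ M t ω} ≤ 1 := by
  set E : ℕ → Set Ω := fun n => {ω | ∃ t ≤ n, c ≤ M t ω} with hE
  have hEm : ∀ n, MeasurableSet[ℱ n] (E n) := by
    intro n
    have : E n = ⋃ t ∈ Finset.range (n + 1), {ω | c ≤ M t ω} := by
      ext ω; simp [hE]
    rw [this]
    refine Finset.measurableSet_biUnion _ fun t ht => ?_
    exact ℱ.mono (Nat.lt_succ_iff.1 (Finset.mem_range.1 ht)) _ (hM t measurableSet_Ici)
  have hEm' : ∀ n, MeasurableSet (E n) := fun n => ℱ.le n _ (hEm n)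
  have hMm : ∀ n, MeasurableSet {ω | c ≤ M n ω} := fun n => ℱ.le n _ (hM n measurableSet_Ici)
  have hsucc : ∀ n, E (n + 1) = E n ∪ ((E n)ᶜ ∩ {ω | c ≤ M (n + 1) ω}) := by
    intro n
    ext ω
    simp only [hE, Set.mem_ofPred_eq, Set.mem_union, Set.mem_inter_iff, Set.mem_compl_iff,
      Nat.le_succ_iff]
    constructor
    · rintro ⟨t, ht | rfl, h⟩
      · exact Or.inl ⟨t, ht, h⟩
      · by_cases h' : ∃ t ≤ n, c ≤ M t ω
        · exact Or.inl h'
        · exact Or.inr ⟨h', h⟩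
    · rintro (⟨t, ht, h⟩ | ⟨-, h⟩)
      · exact ⟨t, Or.inl ht, h⟩
      · exact ⟨n + 1, Or.inr rfl, h⟩
  have hcompl : ∀ n, (E (n + 1))ᶜ = (E n)ᶜ \ {ω | c ≤ M (n + 1) ω} := by
    intro n
    rw [hsucc]
    ext ω
    simp only [Set.mem_compl_iff, Set.mem_union, Set.mem_inter_iff, Set.mem_sdiff]
    tauto
  have hmark : ∀ (s : Set Ω) n, MeasurableSet s → (∀ ω ∈ s, c ≤ M n ω) →
      c * μ s ≤ ∫⁻ ω in s, M n ω ∂μ := fun s n hs h => by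
    rw [← setLIntegral_const]
    exact setLIntegral_mono' hs h
  -- This controls the process stopped at its first crossing of c: mass that has crossed is frozen
  -- at c, the rest still evolves.
  have key : ∀ n, c * μ (E n) + ∫⁻ ω in (E n)ᶜ, M n ω ∂μ ≤ 1 := by
    intro n
    induction n with
    | zero =>
      refine le_trans ?_ ((lintegral_add_compl (M 0) (hEm' 0)).le.trans h0)
      refine add_le_add_left (hmark _ _ (hEm' 0) fun ω hω => by
        obtain ⟨t, ht, h⟩ := hω
        rwa [Nat.le_zero.1 ht] at h) _
    | succ n ih =>
      refine le_trans ?_ ih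
      calc c * μ (E (n + 1)) + ∫⁻ ω in (E (n + 1))ᶜ, M (n + 1) ω ∂μ
          ≤ c * (μ (E n) + μ ((E n)ᶜ ∩ {ω | c ≤ M (n + 1) ω})) +
              ∫⁻ ω in (E n)ᶜ \ {ω | c ≤ M (n + 1) ω}, M (n + 1) ω ∂μ := by
            rw [hcompl, hsucc]
            gcongr
            exact measure_union_le _ _
        _ ≤ c * μ (E n) + (∫⁻ ω in (E n)ᶜ ∩ {ω | c ≤ M (n + 1) ω}, M (n + 1) ω ∂μ +
              ∫⁻ ω in (E n)ᶜ \ {ω | c ≤ M (n + 1) ω}, M (n + 1) ω ∂μ) := by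
            rw [mul_add, add_assoc]
            gcongr
            exact hmark _ _ ((hEm' n).compl.inter (hMm _)) fun ω hω => hω.2
        _ = c * μ (E n) + ∫⁻ ω in (E n)ᶜ, M (n + 1) ω ∂μ := by
            rw [lintegral_inter_add_sdiff _ _ (hMm _)]
        _ ≤ _ := by
            exact add_le_add_right (hstep n _ (hEm n).compl) _
  have hU : {ω | ∃ t, c ≤ M t ω} = ⋃ n, E n := by
    ext ω
    simp only [hE, Set.mem_ofPred_eq, Set.mem_iUnion]
    exact ⟨fun ⟨t, h⟩ => ⟨t, t, le_rfl, h⟩, fun ⟨_, t, _, h⟩ => ⟨t, h⟩⟩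
  have hmono : Monotone E := fun n k hnk ω ⟨t, ht, h⟩ => ⟨t, ht.trans hnk, h⟩
  rw [hU, hmono.measure_iUnion, ENNReal.mul_iSup]
  exact iSup_le fun n => le_trans le_self_add (key n)

end Conditional

/-! ### The self-normalized exponential process -/

section SelfNormalized

variable {d K : ℕ} {x : Fin K → EuclideanSpace ℝ (Fin d)} {P : Params}

/-- The exponential of the self-normalized noise, weighted by the ratio of determinants. -/
def selfNormalizedExp (x : Fin K → EuclideanSpace ℝ (Fin d)) (P : Params) (a : ℕ → Fin K)
    (e : ℕ → ℝ) (t : ℕ) : ℝ :=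
  √((P.lam • (1 : Matrix (Fin d) (Fin d) ℝ)).det / (designMatrix x P a t).det) *
    Real.exp (noiseVec x a e t ⬝ᵥ (designMatrix x P a t)⁻¹ *ᵥ noiseVec x a e t / 2)

lemma noiseVec_succ (a : ℕ → Fin K) (e : ℕ → ℝ) (t : ℕ) :
    noiseVec x a e (t + 1) = noiseVec x a e t + e t • (x (a t)).ofLp := by
  simp [noiseVec, Finset.sum_range_succ]

lemma noiseVec_const_mul (a : ℕ → Fin K) (e : ℕ → ℝ) (c : ℝ) (t : ℕ) :
    noiseVec x a (fun s => c * e s) t = c • noiseVec x a e t := by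
  simp [noiseVec, Finset.smul_sum, mul_smul]

lemma selfNormalizedExp_nonneg (a : ℕ → Fin K) (e : ℕ → ℝ) (t : ℕ) :
    0 ≤ selfNormalizedExp x P a e t := by
  unfold selfNormalizedExp; positivity

lemma selfNormalizedExp_zero (hlam : 0 < P.lam) (a : ℕ → Fin K) (e : ℕ → ℝ) :
    selfNormalizedExp x P a e 0 = 1 := by
  have := (det_smul_one_pos (d := d) hlam).ne'
  simp only [selfNormalizedExp, designMatrix, noiseVec, Finset.range_zero, Finset.sum_empty,
    add_zero, div_self this]
  simp

/-- The determinant grows by the factor 1 + u, which gives (√(1 + u))⁻¹; the rank-one update of the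
inverse gives the exponent. -/
lemma selfNormalizedExp_succ (hlam : 0 < P.lam) (a : ℕ → Fin K) (e : ℕ → ℝ) (t : ℕ) :
    selfNormalizedExp x P a e (t + 1) = selfNormalizedExp x P a e t *
      mixtureFactor ((x (a t)).ofLp ⬝ᵥ (designMatrix x P a t)⁻¹ *ᵥ (x (a t)).ofLp)
        ((x (a t)).ofLp ⬝ᵥ (designMatrix x P a t)⁻¹ *ᵥ noiseVec x a e t) (e t) := by
  have hA := designMatrix_posDef x a hlam t
  have hu := dotProduct_inv_mulVec_nonneg hA (x (a t)).ofLp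
  rw [selfNormalizedExp, selfNormalizedExp, mixtureFactor, noiseVec_succ, designMatrix_succ,
    quadForm_inv_add_vecMulVec_self hA, det_add_vecMulVec_self hA, mul_mul_mul_comm, ← Real.exp_add,
    ← Real.sqrt_inv, ← Real.sqrt_mul (div_nonneg (det_smul_one_pos hlam).le hA.det_pos.le),
    ← div_eq_mul_inv, div_div]
  congr 2
  field_simp

/-- Take logarithms; κ ≥ 1 only enlarges the radius. -/
lemma noise_le_of_selfNormalizedExp_lt (hlam : 0 < P.lam) (hdelta : 0 < P.delta) (hR : 0 < P.R)
    (hkappa : 1 ≤ P.kappa) (a : ℕ → Fin K) (e : ℕ → ℝ) (t : ℕ)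
    (h : selfNormalizedExp x P a (fun s => P.R⁻¹ * e s) t < P.delta⁻¹) :
    √(noiseVec x a e t ⬝ᵥ (designMatrix x P a t)⁻¹ *ᵥ noiseVec x a e t) ≤
      P.R * √(2 * logTerm x a P t) := by
  have hA := designMatrix_posDef x a hlam t
  have hD := hA.det_pos
  have hL := det_smul_one_pos (d := d) hlam
  rw [selfNormalizedExp, noiseVec_const_mul, Matrix.mulVec_smul, smul_dotProduct, dotProduct_smul,
    smul_eq_mul, smul_eq_mul] at h
  set Q := noiseVec x a e t ⬝ᵥ (designMatrix x P a t)⁻¹ *ᵥ noiseVec x a e t with hQ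
  have h1 := Real.log_lt_log (by positivity) h
  rw [Real.log_mul (by positivity) (Real.exp_pos _).ne', Real.log_exp, Real.log_sqrt (by positivity),
    Real.log_div hL.ne' hD.ne', Real.log_inv] at h1
  have h2 := Real.log_nonneg hkappa
  have h3 : P.R⁻¹ * (P.R⁻¹ * Q) ≤ 2 * logTerm x a P t := by
    rw [logTerm_eq x a hlam (by linarith) hdelta]
    linarith
  have h4 : Q = P.R ^ 2 * (P.R⁻¹ * (P.R⁻¹ * Q)) := by field_simp
  rw [h4, Real.sqrt_mul (sq_nonneg _), Real.sqrt_sq hR.le]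
  exact mul_le_mul_of_nonneg_left (Real.sqrt_le_sqrt h3) hR.le

end SelfNormalized

/-! ### Measurability of the process -/

section Measurability

variable {d K : ℕ} {x : Fin K → EuclideanSpace ℝ (Fin d)} {P : Params} {Ω : Type*}
  [MeasurableSpace Ω] {a : ℕ → Ω → Fin K} {t : ℕ}

/-- The matrix depends only on finitely many arms from a finite set, so φ needs no regularity; this
covers entries of the inverse. -/
lemma measurable_comp_designMatrix (ha : ∀ s < t, Measurable (a s))
    (φ : Matrix (Fin d) (Fin d) ℝ → ℝ) :
    Measurable fun ω => φ (designMatrix x P (fun s => a s ω) t) := by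
  have h : (fun ω => φ (designMatrix x P (fun s => a s ω) t)) =
      (fun b : Fin t → Fin K => φ (P.lam • (1 : Matrix (Fin d) (Fin d) ℝ) +
        ∑ s, Matrix.vecMulVec (x (b s)).ofLp (x (b s)).ofLp)) ∘ fun ω s => a s ω := by
    ext ω
    simp [designMatrix, Finset.sum_range]
  rw [h]
  exact (measurable_of_countable _).comp (measurable_pi_lambda _ fun s => ha s s.2)

lemma measurable_dotProduct_inv_mulVec (ha : ∀ s < t, Measurable (a s)) {y z : Ω → Fin d → ℝ}
    (hy : ∀ p, Measurable fun ω => y ω p) (hz : ∀ p, Measurable fun ω => z ω p) :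
    Measurable fun ω => y ω ⬝ᵥ (designMatrix x P (fun s => a s ω) t)⁻¹ *ᵥ z ω := by
  simp only [dotProduct, Matrix.mulVec]
  exact Finset.measurable_fun_sum _ fun p _ => (hy p).mul (Finset.measurable_fun_sum _ fun q _ =>
    (measurable_comp_designMatrix ha fun A => A⁻¹ p q).mul (hz q))

lemma measurable_arm_apply (ha : Measurable (a t)) (p : Fin d) :
    Measurable fun ω => (x (a t ω)).ofLp p :=
  (measurable_of_countable fun k => (x k).ofLp p).comp ha

lemma measurable_noiseVec_apply (ha : ∀ s < t, Measurable (a s)) {e : ℕ → Ω → ℝ}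
    (he : ∀ s < t, Measurable (e s)) (p : Fin d) :
    Measurable fun ω => noiseVec x (fun s => a s ω) (fun s => e s ω) t p := by
  simp only [noiseVec, Finset.sum_apply, Pi.smul_apply, smul_eq_mul]
  exact Finset.measurable_fun_sum _ fun s hs => (he s (Finset.mem_range.1 hs)).mul
    (measurable_arm_apply (ha s (Finset.mem_range.1 hs)) p)

lemma measurable_selfNormalizedExp (ha : ∀ s < t, Measurable (a s)) {e : ℕ → Ω → ℝ}
    (he : ∀ s < t, Measurable (e s)) :
    Measurable fun ω => selfNormalizedExp x P (fun s => a s ω) (fun s => e s ω) t := by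
  have h1 := measurable_comp_designMatrix (x := x) (P := P) ha
    fun A => √((P.lam • (1 : Matrix (Fin d) (Fin d) ℝ)).det / A.det)
  have h2 := measurable_dotProduct_inv_mulVec (x := x) (P := P) ha
    (measurable_noiseVec_apply (x := x) ha he) (measurable_noiseVec_apply (x := x) ha he)
  exact h1.mul (Real.measurable_exp.comp (h2.div_const 2))

end Measurability

/-! ### The probability of the confidence event -/

section Confidence

variable {d K : ℕ} {Ω : Type*} [mΩ : MeasurableSpace Ω] {μ : Measure Ω}
  {ℱ : Filtration ℕ mΩ} {x : Fin K → EuclideanSpace ℝ (Fin d)} {P : Params}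
  {noise : ℕ → Ω → ℝ} {a : ℕ → Ω → Fin K}

/-- The self-normalized concentration inequality for conditionally `1`-sub-Gaussian noise. -/
lemma measure_exists_le_selfNormalizedExp [IsProbabilityMeasure μ] (hlam : 0 < P.lam)
    (hdelta : 0 < P.delta)
    (ha : ∀ t, Measurable[ℱ t] (a t)) {e : ℕ → Ω → ℝ} (he : IsCondSubGaussian μ ℱ 1 e) :
    μ {ω | ∃ t, P.delta⁻¹ ≤ selfNormalizedExp x P (fun s => a s ω) (fun s => e s ω) t} ≤
      ENNReal.ofReal P.delta := by
  have ha' : ∀ t, ∀ s ≤ t, Measurable[ℱ t] (a s) := fun t s hs => (ha s).mono (ℱ.mono hs) le_rfl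
  have he' : ∀ t, ∀ s < t, Measurable[ℱ t] (e s) := fun t s hs =>
    (he.measurable s).mono (ℱ.mono hs) le_rfl
  set M : ℕ → Ω → ENNReal := fun t ω =>
    ENNReal.ofReal (selfNormalizedExp x P (fun s => a s ω) (fun s => e s ω) t) with hMdef
  have hM : ∀ t, Measurable[ℱ t] (M t) := fun t =>
    (@measurable_selfNormalizedExp d K x P Ω (ℱ t) a t (fun s hs => ha' t s hs.le) e
      (he' t)).ennreal_ofReal
  have hville := mul_measure_exists_le_of_supermartingale (μ := μ) ℱ hM
    (by simp [hMdef, selfNormalizedExp_zero hlam]) (fun t s hs => by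
      have hA := fun ω => designMatrix_posDef x (fun s => a s ω) hlam t
      have hx := fun p => @measurable_arm_apply d K x Ω (ℱ t) a t (ha t) p
      have hn := fun p => @measurable_noiseVec_apply d K x Ω (ℱ t) a t
        (fun s hs => ha' t s hs.le) e (he' t) p
      have hu := @measurable_dotProduct_inv_mulVec d K x P Ω (ℱ t) a t
        (fun s hs => ha' t s hs.le) _ _ hx hx
      have hv := @measurable_dotProduct_inv_mulVec d K x P Ω (ℱ t) a t
        (fun s hs => ha' t s hs.le) _ _ hx hn
      -- The weight Z is the process restricted to s. Here u = 0 forces x_{a_t} = 0 and thus v = 0.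
      have h := lintegral_mul_mixtureFactor_le (ℱ.le t)
        ((he.measurable t).mono (ℱ.le _) le_rfl) (he.integrable t)
        (fun s => by simpa using he.condExp_le t s) hu hv
        (fun ω => dotProduct_inv_mulVec_nonneg (hA ω) _) (fun ω h0 => by
          rw [dotProduct_inv_mulVec_eq_zero (hA ω) h0, zero_dotProduct])
        ((hM t).indicator hs)
      rw [← lintegral_indicator (ℱ.le t s hs), ← lintegral_indicator (ℱ.le t s hs)]
      refine le_trans (le_of_eq (lintegral_congr fun ω => ?_)) h
      by_cases hω : ω ∈ s
      · simp only [Set.indicator_of_mem hω, hMdef]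
        rw [selfNormalizedExp_succ hlam, ENNReal.ofReal_mul (selfNormalizedExp_nonneg _ _ _)]
      · simp [Set.indicator_of_notMem hω])
    (ENNReal.ofReal P.delta⁻¹)
  have hset : {ω | ∃ t, P.delta⁻¹ ≤ selfNormalizedExp x P (fun s => a s ω) (fun s => e s ω) t} =
      {ω | ∃ t, ENNReal.ofReal P.delta⁻¹ ≤ M t ω} := by
    ext ω
    simp only [Set.mem_ofPred_eq, hMdef]
    exact exists_congr fun t =>
      (ENNReal.ofReal_le_ofReal_iff (selfNormalizedExp_nonneg _ _ _)).symm
  rw [hset, ENNReal.ofReal_inv_of_pos hdelta]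
  rw [ENNReal.ofReal_inv_of_pos hdelta, mul_comm, ← div_eq_mul_inv] at hville
  simpa using (ENNReal.div_le_iff_le_mul (Or.inl (by simpa using hdelta))
    (Or.inl ENNReal.ofReal_ne_top)).1 hville

/-- Conditionally `0`-sub-Gaussian noise vanishes almost surely. -/
lemma IsCondSubGaussian.ae_eq_zero [IsProbabilityMeasure μ] (h : IsCondSubGaussian μ ℱ 0 noise)
    (t : ℕ) :
    ∀ᵐ ω ∂μ, noise t ω = 0 := by
  have hle : ∀ s : ℝ, ∫ ω, Real.exp (s * noise t ω) ∂μ ≤ 1 := fun s => by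
    rw [← integral_condExp (ℱ.le t)]
    calc _ ≤ ∫ _, Real.exp (s ^ 2 * 0 ^ 2 / 2) ∂μ :=
          integral_mono_ae integrable_condExp (integrable_const _) (h.condExp_le t s)
      _ = 1 := by simp
  -- The bounds at s = 1 and s = -1 give 2(cosh X - 1) ≥ 0 a mean of at most 0, and cosh X = 1 only
  -- at X = 0.
  have hcosh : ∀ ω, Real.exp (1 * noise t ω) + Real.exp ((-1) * noise t ω) - 2 =
      2 * (Real.cosh (noise t ω) - 1) := fun ω => by
    rw [Real.cosh_eq]; simp; ring
  have hadd : Integrable (fun ω => Real.exp (1 * noise t ω) + Real.exp ((-1) * noise t ω)) μ :=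
    (h.integrable t 1).add (h.integrable t (-1))
  have hint : Integrable
      (fun ω => Real.exp (1 * noise t ω) + Real.exp ((-1) * noise t ω) - 2) μ :=
    hadd.sub (integrable_const 2)
  have hnn : 0 ≤ fun ω => Real.exp (1 * noise t ω) + Real.exp ((-1) * noise t ω) - 2 := fun ω => by
    simp only [Pi.zero_apply, hcosh]
    linarith [Real.one_le_cosh (noise t ω)]
  have h0 : ∫ ω, (Real.exp (1 * noise t ω) + Real.exp ((-1) * noise t ω) - 2) ∂μ = 0 := by
    refine le_antisymm ?_ (integral_nonneg hnn)
    rw [integral_sub hadd (integrable_const 2),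
      integral_add (h.integrable t 1) (h.integrable t (-1))]
    simp only [integral_const, probReal_univ, smul_eq_mul]
    linarith [hle 1, hle (-1)]
  filter_upwards [(integral_eq_zero_iff_of_nonneg hnn hint).1 h0] with ω hω
  by_contra hne
  have := Real.one_lt_cosh.2 hne
  simp only [Pi.zero_apply, hcosh] at hω
  linarith

lemma IsCondSubGaussian.inv_mul (hR : 0 < P.R) (h : IsCondSubGaussian μ ℱ P.R noise) :
    IsCondSubGaussian μ ℱ 1 fun t ω => P.R⁻¹ * noise t ω := by
  refine ⟨fun t => (h.measurable t).const_mul _, fun t s => ?_, fun t s => ?_⟩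
  · simpa only [mul_assoc] using h.integrable t (s * P.R⁻¹)
  · have := h.condExp_le t (s * P.R⁻¹)
    simp only [mul_assoc] at this
    convert this using 4
    field_simp

/-- With probability at least `1 - δ`, all confidence intervals are valid. -/
lemma one_sub_le_measureReal_isConfident [IsProbabilityMeasure μ] (hdelta : 0 < P.delta)
    (hlam : 0 < P.lam) (hR : 0 ≤ P.R) (hkappa : 1 ≤ P.kappa) {θ : EuclideanSpace ℝ (Fin d)}
    (hθ : ‖θ‖ ≤ P.S) (hnoise : IsCondSubGaussian μ ℱ P.R noise) (ha : ∀ t, Measurable[ℱ t] (a t)) :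
    1 - P.delta ≤
      μ.real {ω | IsConfident x θ P (fun t => a t ω) (reward x θ noise a ω)} := by
  set G := {ω | IsConfident x θ P (fun t => a t ω) (reward x θ noise a ω)} with hG
  have hbad : μ Gᶜ ≤ ENNReal.ofReal P.delta := by
    -- For R = 0 the noise cannot be rescaled by R⁻¹, but it vanishes almost surely.
    rcases hR.eq_or_lt with h0 | hpos
    · have hz : ∀ᵐ ω ∂μ, ∀ t, noise t ω = 0 := by
        rw [ae_all_iff]
        rw [← h0] at hnoise
        exact hnoise.ae_eq_zero
      have : ∀ᵐ ω ∂μ, ω ∈ G := by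
        filter_upwards [hz] with ω hω
        refine isConfident_of_noise_le x θ _ hlam hθ _ fun t => ?_
        have : noiseVec x (fun t => a t ω) (fun s => noise s ω) t = 0 := by simp [noiseVec, hω]
        simp only [this, zero_dotProduct, Real.sqrt_zero]
        positivity
      rw [show μ Gᶜ = 0 from this]
      exact zero_le
    · refine le_trans (measure_mono fun ω hω => ?_)
        (measure_exists_le_selfNormalizedExp (x := x) hlam hdelta ha (hnoise.inv_mul hpos))
      by_contra hcon
      simp only [Set.mem_ofPred_eq, not_exists, not_le] at hcon
      exact hω (isConfident_of_noise_le x θ _ hlam hθ _ fun t =>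
        noise_le_of_selfNormalizedExp_lt hlam hdelta hpos hkappa _ _ t (hcon t))
  have h1 : μ.real Gᶜ ≤ P.delta := ENNReal.toReal_le_of_le_ofReal hdelta.le hbad
  -- Subadditivity replaces the complement rule, so G need not be measurable.
  have h2 : (1 : ℝ) ≤ μ.real G + μ.real Gᶜ := by
    have := measureReal_union_le (μ := μ) G Gᶜ
    rwa [Set.union_compl_self, probReal_univ] at this
  linarith

end Confidence

end LinGapE

end

/-! ### The theorem -/

theorem theorem2 {d K : ℕ} {Ω : Type*} [mΩ : MeasurableSpace Ω]
    (μ : Measure Ω) [IsProbabilityMeasure μ] (ℱ : Filtration ℕ mΩ)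
    (x : Fin K → EuclideanSpace ℝ (Fin d)) (θ : EuclideanSpace ℝ (Fin d))
    (P : LinGapE.Params)
    (heps : 0 ≤ P.eps) (hdelta : 0 < P.delta) (hdelta1 : P.delta < 1) (hlam : 0 < P.lam)
    (hR : 0 ≤ P.R) (hS : 0 < P.S) (hθ : ‖θ‖ ≤ P.S)
    (hkappa : P.kappa = 1 ∨ P.kappa = (K : ℝ) ^ 2)
    (best : Fin K) (hbest : ∀ i, inner ℝ (x i) θ ≤ inner ℝ (x best) θ)
    (hfin : 0 < P.eps ∨ ∀ i, i ≠ best → inner ℝ (x i) θ < inner ℝ (x best) θ)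
    (w : EuclideanSpace ℝ (Fin d) → Fin K → ℝ)
    (hw : ∀ i j, LinGapE.IsL1Solution x (x i - x j) (w (x i - x j)))
    (noise : ℕ → Ω → ℝ) (hnoise : LinGapE.IsCondSubGaussian μ ℱ P.R noise)
    (a i j : ℕ → Ω → Fin K) (hrun : LinGapE.IsLinGapE x θ P w ℱ noise a i j)
    (H : ℝ) (hH : H = LinGapE.complexity x θ w P.eps best)
    (L : ℝ) (hL : L = LinGapE.maxNorm x) :
    -- the bound for small regularization
    (P.lam ≤ 2 * P.R ^ 2 / P.S ^ 2 * Real.log ((K : ℝ) ^ 2 / P.delta) →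
      1 - P.delta ≤ μ.real {ω | ∃ n : ℕ, LinGapE.tau x θ P noise a i ω = n ∧
        (n : ℝ) ≤ 8 * H * P.R ^ 2 * Real.log ((K : ℝ) ^ 2 / P.delta) +
          LinGapE.remainder K d P.R L P.lam H P.delta}) ∧
    -- the order of the remainder, uniformly over all dimensions, complexities bounded below,
    -- confidence levels bounded away from one and regularizations bounded below
    (∀ h₀ δ₀ lam₀ η : ℝ, 0 < h₀ → δ₀ < 1 → 0 < lam₀ → 1 < η →
      ∃ c : ℝ, ∀ (d' : ℕ) (H' δ' lam' : ℝ), 1 ≤ d' → h₀ ≤ H' → 0 < δ' → δ' ≤ δ₀ →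
        lam₀ ≤ lam' → η ≤ d' * H' * Real.log (1 / δ') →
          LinGapE.remainder K d' P.R L lam' H' δ' ≤
            c * (d' * H' * Real.log (d' * H' * Real.log (1 / δ')))) ∧
    -- the bound for large regularization
    (4 * H * P.R ^ 2 * L ^ 2 < P.lam →
      1 - P.delta ≤ μ.real {ω | ∃ n : ℕ, LinGapE.tau x θ P noise a i ω = n ∧
        (n : ℝ) ≤ 8 * H * P.R ^ 2 * Real.log ((K : ℝ) ^ 2 / P.delta) +
          4 * H * P.lam * P.S ^ 2 + 2 * K}) := by
  subst hH hL
  have hK : 1 ≤ K := Nat.one_le_iff_ne_zero.2 fun h => (h ▸ best).elim0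
  have hkappa1 : 1 ≤ P.kappa := by
    rcases hkappa with h | h <;> rw [h]
    exact one_le_pow₀ (by exact_mod_cast hK)
  have hprob := LinGapE.one_sub_le_measureReal_isConfident (x := x) hdelta hlam hR hkappa1 hθ hnoise
    hrun.arm_measurable
  refine ⟨fun hsmall => hprob.trans (measureReal_mono fun ω hω => ?_),
    fun h₀ δ₀ lam₀ η h1 h2 h3 h4 =>
    LinGapE.remainder_le hK P.R _ h1 h2 h3 h4,
    fun hlarge => hprob.trans (measureReal_mono fun ω hω => ?_)⟩
  · exact LinGapE.stopTime_le_of_small_regularization heps hdelta hdelta1 hlam hR hS hkappa hbest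
      hfin hw hω (hrun.run ω) hsmall
  · exact LinGapE.stopTime_le_of_large_regularization heps hdelta hdelta1 hlam hR hS hkappa hbest
      hfin hw hω (hrun.run ω) hlarge
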